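/- Let $n\in\mathbb N$, let $|\cdot|$ be the Euclidean norm on $\mathbb R^n$, and let $\overline B_r$ be the closed ball of $\mathbb R^n$ with centre $0$ and radius $r$. Let $(\Omega,\mathcal F,\mathbb P)$ be a probability space with an ergodic group $(\tau_k)_{k\in\mathbb Z}$ of measure preserving transformations: $\tau_0=\mathrm{id}$, $\tau_{k+k'}=\tau_k\circ\tau_{k'}$, each $\tau_k$ preserves $\mathbb P$, and every $U\in\mathcal F$ with $\tau_k(U)=U$ for all $k\in\mathbb Z$ has $\mathbb P[U]\in\{0,1\}$. Let $a:\mathbb R^n\times\mathbb R\times\Omega\to\mathbb R$ satisfy assumption (A): * $a$ is measurable with respect to $\mathcal B(\mathbb R^{n+1})\otimes\mathcal F$; * $a(x+l,t,\tau_k\omega)=a(x,t+k,\omega)$ for all $x\in\mathbb R^n$, $l\in\mathbb Z^n$, $t\in\mathbb R$, $k\in\mathbb Z$, $\omega\in\Omega$; * for each $\omega\in\Omega$, the function $a(\cdot,\cdot,\omega)$ is Lipschitz continuous on $\mathbb R^{n+1}$, and there are constants $\alpha,\beta>0$ with $\alpha\le a(x,t,\omega)\le\beta$ for all $(x,t,\omega)$.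 Let $Y=[0,1]^n$. For $t\ge 0$ and $\omega\in\Omega$ let $\mathcal R_t(Y)(\omega)$ be the set of all $\gamma(t)$, where $\gamma:[0,t]\to\mathbb R^n$ is absolutely continuous with $\gamma(0)\in Y$ and $|\gamma'(r)|\le a(\gamma(r),r,\omega)$ for almost every $r\in[0,t]$. Let $\mathrm{co}$ denote the convex hull and, for integers $0\le m<k$, put $$X_{m,k}(\omega):=\mathrm{co}\,\mathcal R_{k-m}(Y)(\tau_m\omega)+(-Y).$$ Let $\mathscr C$ be the set of non-empty compact subsets of $\mathbb R^n$ and $\rho$ the Hausdorff metric on $\mathscr C$. **Theorem.** There exist a (deterministic) compact convex set $D\subset\mathbb R^n$ with $$\overline B_\alpha\subset D\subset\overline B_\beta$$ and an event $\Omega_0\in\mathcal F$ with $\mathbb P[\Omega_0]=1$ such that, for every $\omega\in\Omega_0$, as $m\to\infty$ along the positive integers, $$\frac{X_{0,m}(\omega)}{m}\longrightarrow D\qquad\text{and}\qquad\frac{\mathrm{co}\,\mathcal R_m(Y)(\omega)}{m}\longrightarrow D\qquad\text{in }(\mathscr C,\rho).$$ -/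

import Mathlib

open MeasureTheory Filter Topology
open scoped Pointwise

namespace ReachableSets

/-- An ergodic group `(τ_k)_{k ∈ ℤ}` of measure preserving transformations of the
probability space `(Ω, 𝓕, P)`: every event invariant under all `τ_k` has probability `0` or `1`. -/
structure IsErgodicGroup {Ω : Type*} [MeasurableSpace Ω] (P : Measure Ω) (τ : ℤ → Ω → Ω) :
    Prop where
  map_zero : τ 0 = id
  map_add : ∀ k k' : ℤ, τ (k + k') = τ k ∘ τ k'
  measurePreserving : ∀ k : ℤ, MeasurePreserving (τ k) P P
  ergodic : ∀ U : Set Ω, MeasurableSet U → (∀ k : ℤ, τ k '' U = U) → P U = 1 ∨ P U = 0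

/-- The standing assumption (A) on the velocity `a : ℝⁿ × ℝ × Ω → ℝ`: joint measurability,
`ℤⁿ`-periodicity in space and stationarity in time with respect to `τ`, Lipschitz continuity in
`(x, t)` for each `ω` (with a constant that may depend on `ω`), and the uniform bounds
`0 < α ≤ a ≤ β`. -/
structure AssumptionA {n : ℕ} {Ω : Type*} [MeasurableSpace Ω] (τ : ℤ → Ω → Ω)
    (a : EuclideanSpace ℝ (Fin n) → ℝ → Ω → ℝ) (α β : ℝ) : Prop where
  measurable : Measurable
    (fun p : (EuclideanSpace ℝ (Fin n) × ℝ) × Ω => a p.1.1 p.1.2 p.2)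
  periodic_stationary : ∀ (x l : EuclideanSpace ℝ (Fin n)), (∀ i, ∃ z : ℤ, l i = z) →
    ∀ (t : ℝ) (k : ℤ) (ω : Ω), a (x + l) t (τ k ω) = a x (t + k) ω
  lipschitz : ∀ ω : Ω, ∃ K : NNReal,
    LipschitzWith K (fun p : EuclideanSpace ℝ (Fin n) × ℝ => a p.1 p.2 ω)
  alpha_pos : 0 < α
  beta_pos : 0 < β
  lower : ∀ x t ω, α ≤ a x t ω
  upper : ∀ x t ω, a x t ω ≤ β

/-- The unit cell `Y = [0,1]ⁿ`. -/
def unitCell (n : ℕ) : Set (EuclideanSpace ℝ (Fin n)) :=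
  {x | ∀ i, 0 ≤ x i ∧ x i ≤ 1}

/-- Admissible paths `𝒜_{s,t}(ω)`: absolutely continuous `γ : [s,t] → ℝⁿ` such that
`|γ'(r)| ≤ a(γ(r), r, ω)` for almost every `r ∈ [s,t]`. A path is represented by a function on `ℝ`
of which only the values on `[s,t]` matter (the end points are a null set). -/
def admissible {n : ℕ} {Ω : Type*} (a : EuclideanSpace ℝ (Fin n) → ℝ → Ω → ℝ)
    (s t : ℝ) (ω : Ω) : Set (ℝ → EuclideanSpace ℝ (Fin n)) :=
  {γ | AbsolutelyContinuousOnInterval γ s t ∧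
    ∀ᵐ r ∂(volume : Measure ℝ), r ∈ Set.Icc s t →
      DifferentiableAt ℝ γ r ∧ ‖deriv γ r‖ ≤ a (γ r) r ω}

/-- The reachable set `ℛ_t(x, s)(ω)` at time `t ≥ s`, starting from `x` at time `s`. -/
def reach {n : ℕ} {Ω : Type*} (a : EuclideanSpace ℝ (Fin n) → ℝ → Ω → ℝ)
    (t : ℝ) (x : EuclideanSpace ℝ (Fin n)) (s : ℝ) (ω : Ω) : Set (EuclideanSpace ℝ (Fin n)) :=
  {y | ∃ γ ∈ admissible a s t ω, γ s = x ∧ γ t = y}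

/-- The enlarged reachable set `ℛ_t(Y)(ω) = ⋃_{x ∈ Y} ℛ_t(x, 0)(ω)`. -/
def reachY {n : ℕ} {Ω : Type*} (a : EuclideanSpace ℝ (Fin n) → ℝ → Ω → ℝ)
    (t : ℝ) (ω : Ω) : Set (EuclideanSpace ℝ (Fin n)) :=
  ⋃ x ∈ unitCell n, reach a t x 0 ω

/-- The family `X_{m,k}(ω) = co ℛ_{k-m}(Y)(τ_m ω) + (-Y)`, for `0 ≤ m < k`. -/
def X {n : ℕ} {Ω : Type*} (τ : ℤ → Ω → Ω) (a : EuclideanSpace ℝ (Fin n) → ℝ → Ω → ℝ)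
    (m k : ℕ) (ω : Ω) : Set (EuclideanSpace ℝ (Fin n)) :=
  convexHull ℝ (reachY a ((k : ℝ) - (m : ℝ)) (τ (m : ℤ) ω)) + (-unitCell n)

/-- `A_m → D`, as `m → ∞`, in the space of non-empty compact subsets of `ℝⁿ` with the
Hausdorff metric: all the sets (for integers `m ≥ 1`) belong to that space, and the Hausdorff
distance tends to `0`. -/
def TendstoHausdorff {n : ℕ} (A : ℕ → Set (EuclideanSpace ℝ (Fin n)))
    (D : Set (EuclideanSpace ℝ (Fin n))) : Prop :=
  (∀ m : ℕ, 1 ≤ m → (A m).Nonempty ∧ IsCompact (A m)) ∧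
  (D.Nonempty ∧ IsCompact D) ∧
  Tendsto (fun m : ℕ => Metric.hausdorffDist (A m) D) atTop (𝓝 0)

end ReachableSets

/-! The support function of a convex hull is that of the set itself, so the theorem reduces to the
growth of h_m(u) = `supportFn (reachY a m ω) u` for fixed u. Cutting a path at time m and moving its
remainder back to the unit cell by a lattice vector gives h_{m+k} ≤ h_m + h_k∘τ_m up to a constant.
Conversely, since every velocity of norm at most α is allowed, two paths can be joined after a
bounded delay, which gives the opposite inequality. Hence h is almost additive, with an error
independent of m, k and ω (`AssumptionA.supportFn_reachY_almost_additive`).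

Because the defect is bounded on both sides, Birkhoff's theorem is enough: h_m/m is asymptotically
within C/L of E[h_L]/L for each L, so these means are Cauchy and h_m/m tends a.s. to a constant
(`exists_ae_tendsto_div_of_almost_additive`). Measurability of h_m comes from compactness of the
space of Lipschitz curves.

On a countable dense set of directions all limits hold on one event. Support functions of uniformly
bounded sets are equi-Lipschitz and control the Hausdorff distance of compact convex sets, so the
scaled hulls converge (`exists_tendsto_hausdorffDist`), and the limit is deterministic because the
limiting constants are. Adding -Y moves the scaled sets by at most √n/m. -/

namespace ReachableSets

/-! ### Birkhoff's theorem and almost additive processes -/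

section Ergodic

variable {Ω : Type*} {T : Ω → Ω} {g : Ω → ℝ}

/-- The running maximum `max (0, S₁, …, Sₙ)` of the Birkhoff sums of `g`. -/
noncomputable def birkhoffMax (T : Ω → Ω) (g : Ω → ℝ) : ℕ → Ω → ℝ
  | 0 => fun _ => 0
  | n + 1 => fun ω => max 0 (g ω + birkhoffMax T g n (T ω))

theorem birkhoffMax_nonneg (n : ℕ) (ω : Ω) : 0 ≤ birkhoffMax T g n ω := by
  cases n with
  | zero => exact le_rfl
  | succ n => exact le_max_left _ _

theorem birkhoffMax_le_succ (n : ℕ) (ω : Ω) :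
    birkhoffMax T g n ω ≤ birkhoffMax T g (n + 1) ω := by
  induction n generalizing ω with
  | zero => exact birkhoffMax_nonneg 1 ω
  | succ n ih => exact max_le_max le_rfl (add_le_add le_rfl (ih _))

theorem birkhoffSum_le_birkhoffMax (n : ℕ) (ω : Ω) :
    birkhoffSum T g n ω ≤ birkhoffMax T g n ω := by
  induction n generalizing ω with
  | zero => simp [birkhoffMax]
  | succ n ih =>
    rw [birkhoffSum_succ']
    exact le_max_of_le_right (add_le_add le_rfl (ih _))

/-- If `f` is almost additive along `T`, then `L f_m` is, up to an error of order `m C`, the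
Birkhoff sum of `f_L`. -/
theorem abs_birkhoffSum_sub_le {f : ℕ → Ω → ℝ} {C : ℝ} {B : ℕ → ℝ}
    (hadd : ∀ m k ω, |f (m + k) ω - f m ω - f k (T^[m] ω)| ≤ C) (hbd : ∀ m ω, |f m ω| ≤ B m)
    (L m : ℕ) (ω : Ω) :
    |birkhoffSum T (f L) m ω - L * f m ω| ≤ m * C + ∑ j ∈ Finset.range L, (C + 2 * B j) := by
  have h1 : |birkhoffSum T (f L) m ω - ∑ i ∈ Finset.range m, (f (i + L) ω - f i ω)| ≤ m * C := by
    rw [birkhoffSum, ← Finset.sum_sub_distrib]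
    refine (Finset.abs_sum_le_sum_abs _ _).trans ?_
    refine (Finset.sum_le_sum fun i _ => ?_).trans (by simp : ∑ i ∈ Finset.range m, C ≤ m * C)
    rw [abs_sub_comm]
    exact hadd i L ω
  -- Both sides are the sum of the f_i over i < m + L, minus those over i < m and over i < L.
  have h2 : ∑ i ∈ Finset.range m, (f (i + L) ω - f i ω)
      = ∑ j ∈ Finset.range L, (f (m + j) ω - f j ω) := by
    have e1 := Finset.sum_range_add (fun i => f i ω) m L
    have e2 := Finset.sum_range_add (fun i => f i ω) L m
    rw [add_comm L m] at e2
    simp only [Finset.sum_sub_distrib]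
    have e3 : ∑ i ∈ Finset.range m, f (i + L) ω = ∑ i ∈ Finset.range m, f (L + i) ω :=
      Finset.sum_congr rfl fun i _ => by rw [add_comm]
    linarith
  have h3 : |∑ j ∈ Finset.range L, (f (m + j) ω - f j ω) - L * f m ω|
      ≤ ∑ j ∈ Finset.range L, (C + 2 * B j) := by
    have e : (L : ℝ) * f m ω = ∑ j ∈ Finset.range L, f m ω := by simp
    rw [e, ← Finset.sum_sub_distrib]
    refine (Finset.abs_sum_le_sum_abs _ _).trans (Finset.sum_le_sum fun j _ => ?_)
    have a1 := abs_le.1 (hadd m j ω)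
    have a2 := abs_le.1 (hbd j (T^[m] ω))
    have a3 := abs_le.1 (hbd j ω)
    rw [abs_le]
    constructor <;> linarith [a1.1, a1.2]
  rw [h2] at h1
  have a1 := abs_le.1 h1
  have a2 := abs_le.1 h3
  rw [abs_le]
  constructor <;> linarith [a1.1, a1.2]

variable [MeasurableSpace Ω] {P : Measure Ω}

theorem integrable_birkhoffMax (hT : MeasurePreserving T P P) (hg : Integrable g P) (n : ℕ) :
    Integrable (birkhoffMax T g n) P := by
  induction n with
  | zero => exact integrable_zero _ _ _
  | succ n ih =>
    exact (integrable_zero _ _ _).sup (hg.add ((hT.integrable_comp ih.aestronglyMeasurable).2 ih))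

theorem measurable_birkhoffMax (hT : Measurable T) (hg : Measurable g) (n : ℕ) :
    Measurable (birkhoffMax T g n) := by
  induction n with
  | zero => exact measurable_const
  | succ n ih => exact measurable_const.max (hg.add (ih.comp hT))

/-- Garsia's argument: M - M∘T is at most g where the maximum M is positive and at most 0 elsewhere,
while its integral vanishes by invariance. -/
theorem setIntegral_birkhoffMax_pos_nonneg (hT : MeasurePreserving T P P) (hgm : Measurable g)
    (hg : Integrable g P) (n : ℕ) : 0 ≤ ∫ ω in {ω | 0 < birkhoffMax T g n ω}, g ω ∂P := by
  have hmeas : MeasurableSet {ω | 0 < birkhoffMax T g n ω} :=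
    measurableSet_lt measurable_const (measurable_birkhoffMax hT.measurable hgm n)
  have hM := integrable_birkhoffMax hT hg n
  have hMT := (hT.integrable_comp hM.aestronglyMeasurable).2 hM
  have h0 : ∫ ω, (birkhoffMax T g n ω - birkhoffMax T g n (T ω)) ∂P = 0 := by
    have h1 : ∫ ω, birkhoffMax T g n (T ω) ∂P = ∫ ω, birkhoffMax T g n ω ∂P := by
      rw [← integral_map hT.aemeasurable (by rw [hT.map_eq]; exact hM.aestronglyMeasurable),
        hT.map_eq]
    exact (integral_sub hM hMT).trans (sub_eq_zero.2 h1.symm)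
  rw [← integral_indicator hmeas]
  refine h0.symm.le.trans ?_
  refine integral_mono (hM.sub hMT) (hg.indicator hmeas) fun ω => ?_
  by_cases h : 0 < birkhoffMax T g n ω
  · rw [Set.indicator_of_mem (by exact h)]
    cases n with
    | zero => exact absurd h (lt_irrefl _)
    | succ n =>
      have h2 : birkhoffMax T g (n + 1) ω = g ω + birkhoffMax T g n (T ω) := by
        refine max_eq_right (le_of_not_gt fun h3 => ?_)
        exact h.ne' (max_eq_left h3.le)
      have := birkhoffMax_le_succ (T := T) (g := g) n (T ω)
      linarith
  · rw [Set.indicator_of_notMem (by exact h)]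
    have := birkhoffMax_nonneg (T := T) (g := g) n (T ω)
    linarith

/-- The maximal ergodic inequality. -/
theorem setIntegral_iUnion_birkhoffMax_pos_nonneg (hT : MeasurePreserving T P P)
    (hgm : Measurable g) (hg : Integrable g P) :
    0 ≤ ∫ ω in ⋃ n, {ω | 0 < birkhoffMax T g n ω}, g ω ∂P := by
  have hmono : Monotone fun n => {ω | 0 < birkhoffMax T g n ω} :=
    monotone_nat_of_le_succ fun n ω h => lt_of_lt_of_le h (birkhoffMax_le_succ n ω)
  refine ge_of_tendsto' (tendsto_setIntegral_of_monotone (fun n => ?_) hmono hg.integrableOn)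
    fun n => setIntegral_birkhoffMax_pos_nonneg hT hgm hg n
  exact measurableSet_lt measurable_const (measurable_birkhoffMax hT.measurable hgm n)

/-- Boundedness above of the Birkhoff sums is an invariant event. Were it null, some running maximum
would be positive almost everywhere, and the maximal inequality would force a non-negative integral.
-/
theorem ae_bddAbove_birkhoffSum [IsProbabilityMeasure P] (hT : Ergodic T P) (hgm : Measurable g)
    (hg : Integrable g P) (hneg : ∫ ω, g ω ∂P < 0) :
    ∀ᵐ ω ∂P, ∃ C : ℕ, ∀ n, birkhoffSum T g n ω ≤ C := by
  have hSm : ∀ n, Measurable (birkhoffSum T g n) := fun n => by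
    unfold birkhoffSum
    exact Finset.measurable_sum _ fun i _ => hgm.comp (hT.measurable.iterate i)
  set B : Set Ω := {ω | ∃ C : ℕ, ∀ n, birkhoffSum T g n ω ≤ C} with hB
  have hBm : MeasurableSet B := by
    have : B = ⋃ C : ℕ, ⋂ n, {ω | birkhoffSum T g n ω ≤ C} := by ext; simp [hB]
    rw [this]
    exact .iUnion fun C => .iInter fun n => measurableSet_le (hSm n) measurable_const
  have hBinv : T ⁻¹' B = B := by
    ext ω
    constructor
    · rintro ⟨C, hC⟩
      obtain ⟨C', hC'⟩ := exists_nat_ge (max 0 (g ω + C))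
      refine ⟨C', fun n => le_trans ?_ hC'⟩
      cases n with
      | zero => simp
      | succ n =>
        rw [birkhoffSum_succ']
        exact le_max_of_le_right (add_le_add le_rfl (hC n))
    · rintro ⟨C, hC⟩
      obtain ⟨C', hC'⟩ := exists_nat_ge (C - g ω)
      refine ⟨C', fun n => le_trans ?_ hC'⟩
      have := hC (n + 1)
      rw [birkhoffSum_succ'] at this
      linarith
  rcases hT.toPreErgodic.ae_mem_or_ae_notMem hBm hBinv with h | h
  · exact h
  · exfalso
    have hall : ∀ᵐ ω ∂P, ω ∈ ⋃ n, {ω | 0 < birkhoffMax T g n ω} := by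
      filter_upwards [h] with ω hω
      by_contra hcon
      refine hω ⟨0, fun n => ?_⟩
      have h1 : ¬ 0 < birkhoffMax T g n ω := fun h2 => hcon (Set.mem_iUnion.2 ⟨n, h2⟩)
      have := birkhoffSum_le_birkhoffMax (T := T) (g := g) n ω
      push_cast
      linarith
    have h3 := setIntegral_iUnion_birkhoffMax_pos_nonneg hT.toMeasurePreserving hgm hg
    rw [setIntegral_congr_set (eventuallyEq_univ.2 (by exact hall)), setIntegral_univ] at h3
    linarith

theorem ae_eventually_birkhoffSum_le [IsProbabilityMeasure P] (hT : Ergodic T P)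
    (hgm : Measurable g) (hg : Integrable g P) :
    ∀ᵐ ω ∂P, ∀ ε : ℝ, 0 < ε →
      ∀ᶠ n : ℕ in atTop, birkhoffSum T g n ω ≤ n * (∫ ω, g ω ∂P + ε) := by
  have key : ∀ j : ℕ, ∀ᵐ ω ∂P, ∃ C : ℕ, ∀ n,
      birkhoffSum T (fun ω => g ω - (∫ ω, g ω ∂P + 1 / ((j : ℝ) + 1))) n ω ≤ C := fun j => by
    refine ae_bddAbove_birkhoffSum hT (hgm.sub_const _) (hg.sub (integrable_const _)) ?_
    rw [integral_sub hg (integrable_const _)]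
    simp only [integral_const, probReal_univ, one_smul]
    have : (0 : ℝ) < 1 / ((j : ℝ) + 1) := by positivity
    linarith
  filter_upwards [ae_all_iff.2 key] with ω hω ε hε
  obtain ⟨j, hj⟩ := exists_nat_one_div_lt (half_pos hε)
  obtain ⟨C, hC⟩ := hω j
  obtain ⟨N, hN⟩ := exists_nat_ge (C / (ε / 2))
  filter_upwards [eventually_ge_atTop N] with n hn
  have h1 := hC n
  have h2 : birkhoffSum T (fun ω => g ω - (∫ ω, g ω ∂P + 1 / ((j : ℝ) + 1))) n ω
      = birkhoffSum T g n ω - n * (∫ ω, g ω ∂P + 1 / ((j : ℝ) + 1)) := by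
    simp only [birkhoffSum, Finset.sum_sub_distrib, Finset.sum_const, Finset.card_range,
      nsmul_eq_mul]
  rw [h2] at h1
  have h3 : (C : ℝ) ≤ n * (ε / 2) := by
    rw [div_le_iff₀ (by positivity)] at hN
    have : (N : ℝ) ≤ n := by exact_mod_cast hn
    nlinarith
  have h4 : (n : ℝ) * (1 / ((j : ℝ) + 1)) ≤ n * (ε / 2) :=
    mul_le_mul_of_nonneg_left hj.le n.cast_nonneg
  linarith

/-- **Birkhoff's ergodic theorem** for an ergodic transformation of a probability space. -/
theorem ae_tendsto_birkhoffSum_div [IsProbabilityMeasure P] (hT : Ergodic T P)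
    (hgm : Measurable g) (hg : Integrable g P) :
    ∀ᵐ ω ∂P, Tendsto (fun n : ℕ => birkhoffSum T g n ω / n) atTop (𝓝 (∫ ω, g ω ∂P)) := by
  filter_upwards [ae_eventually_birkhoffSum_le hT hgm hg,
    ae_eventually_birkhoffSum_le hT hgm.neg hg.neg] with ω h1 h2
  rw [Metric.tendsto_nhds]
  intro ε hε
  filter_upwards [h1 (ε / 2) (half_pos hε), h2 (ε / 2) (half_pos hε), eventually_gt_atTop 0]
    with n h3 h4 hn
  have hn' : (0 : ℝ) < n := by exact_mod_cast hn
  have h5 : birkhoffSum T (-g) n ω = - birkhoffSum T g n ω := by simp [birkhoffSum]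
  rw [h5] at h4
  simp only [Pi.neg_apply, integral_neg] at h4
  rw [Real.dist_eq, abs_lt, lt_sub_iff_add_lt, sub_lt_iff_lt_add, lt_div_iff₀ hn', div_lt_iff₀ hn']
  constructor <;> nlinarith

/-- The ergodic theorem for almost additive processes. -/
theorem exists_ae_tendsto_div_of_almost_additive [IsProbabilityMeasure P] (hT : Ergodic T P)
    {f : ℕ → Ω → ℝ} {C : ℝ} {B : ℕ → ℝ} (hf : ∀ m, Measurable (f m))
    (hadd : ∀ m k ω, |f (m + k) ω - f m ω - f k (T^[m] ω)| ≤ C) (hbd : ∀ m ω, |f m ω| ≤ B m) :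
    ∃ c : ℝ, ∀ᵐ ω ∂P, Tendsto (fun m : ℕ => f m ω / m) atTop (𝓝 c) := by
  have hint : ∀ m, Integrable (f m) P := fun m =>
    Integrable.of_bound (hf m).aestronglyMeasurable (B m) (ae_of_all _ fun ω => hbd m ω)
  have hC : 0 ≤ C := by
    obtain ⟨ω⟩ := P.nonempty_of_neZero
    exact (abs_nonneg _).trans (hadd 0 0 ω)
  have hB := ae_all_iff.2 fun L => ae_tendsto_birkhoffSum_div hT (hf L) (hint L)
  set e : ℕ → ℝ := fun L => (∫ ω, f L ω ∂P) / L with he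
  -- Divide `abs_birkhoffSum_sub_le` by L m: the errors are C/L, a term of order 1/m and the
  -- Birkhoff error for f_L.
  have hclose : ∀ ω, (∀ L, Tendsto (fun n : ℕ => birkhoffSum T (f L) n ω / n) atTop
      (𝓝 (∫ ω, f L ω ∂P))) → ∀ L : ℕ, 0 < L → ∀ ε > 0, ∀ᶠ m : ℕ in atTop,
      |f m ω / m - e L| ≤ C / L + ε := by
    intro ω hω L hL ε hε
    have hL' : (0 : ℝ) < L := by exact_mod_cast hL
    set D := ∑ j ∈ Finset.range L, (C + 2 * B j)
    have hlim : Tendsto (fun m : ℕ => |birkhoffSum T (f L) m ω / m - ∫ ω, f L ω ∂P| / L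
        + C / L + D / L / m) atTop (𝓝 (|∫ ω, f L ω ∂P - ∫ ω, f L ω ∂P| / L + C / L + 0)) :=
      ((((hω L).sub_const _).abs.div_const _).add_const _).add
        (tendsto_const_div_atTop_nhds_zero_nat _)
    rw [sub_self, abs_zero, zero_div, zero_add, add_zero] at hlim
    filter_upwards [hlim.eventually (eventually_le_nhds (lt_add_of_pos_right (C / (L : ℝ)) hε)),
      eventually_gt_atTop 0] with m hm hm0
    have hm' : (0 : ℝ) < m := by exact_mod_cast hm0
    refine le_trans ?_ hm
    have h1 := abs_birkhoffSum_sub_le hadd hbd L m ω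
    have h2 : f m ω / m - e L = -((birkhoffSum T (f L) m ω - L * f m ω) / (L * m))
        + (birkhoffSum T (f L) m ω / m - ∫ ω, f L ω ∂P) / L := by
      simp only [he]
      field_simp
      ring
    rw [h2]
    refine (abs_add_le _ _).trans ?_
    rw [abs_neg, abs_div, abs_div, abs_of_pos hL', abs_of_pos (mul_pos hL' hm')]
    have h3 : |birkhoffSum T (f L) m ω - L * f m ω| / (L * m) ≤ (m * C + D) / (L * m) := by
      gcongr
    have h4 : (m * C + D) / (L * m) = C / L + D / L / m := by field_simp
    linarith
  -- Both means are compared with f_m/m at one good ω and one large m; the resulting bound no longer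
  -- involves either.
  have hpair : ∀ L L' : ℕ, 0 < L → 0 < L' → |e L - e L'| ≤ C / L + C / L' := by
    intro L L' hL hL'
    obtain ⟨ω, hω⟩ := hB.exists
    refine le_of_forall_pos_le_add fun ε hε => ?_
    obtain ⟨m, h1, h2⟩ := ((hclose ω hω L hL (ε / 2) (half_pos hε)).and
      (hclose ω hω L' hL' (ε / 2) (half_pos hε))).exists
    have a1 := abs_le.1 h1
    have a2 := abs_le.1 h2
    rw [abs_le]
    constructor <;> linarith [a1.1, a1.2]
  have hcauchy : CauchySeq e := by
    rw [Metric.cauchySeq_iff']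
    intro ε hε
    obtain ⟨N, hN⟩ := exists_nat_gt (2 * C / ε)
    refine ⟨N + 1, fun n hn => ?_⟩
    have h1 := hpair n (N + 1) (by omega) (by omega)
    have hn' : ((N + 1 : ℕ) : ℝ) ≤ n := by exact_mod_cast hn
    have hN0 : (0 : ℝ) < ((N + 1 : ℕ) : ℝ) := by positivity
    have h2 : C / n ≤ C / ((N + 1 : ℕ) : ℝ) := by gcongr
    have h3 : C / ((N + 1 : ℕ) : ℝ) < ε / 2 := by
      rw [div_lt_iff₀ hN0]
      rw [div_lt_iff₀ hε] at hN
      push_cast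
      nlinarith
    rw [Real.dist_eq]
    linarith
  obtain ⟨c, hc⟩ := cauchySeq_tendsto_of_complete hcauchy
  have hec : ∀ L : ℕ, 0 < L → |e L - c| ≤ C / L := by
    intro L hL
    have h1 : Tendsto (fun L' : ℕ => C / (L : ℝ) + C / (L' : ℝ)) atTop (𝓝 (C / L + 0)) :=
      (tendsto_const_div_atTop_nhds_zero_nat C).const_add _
    rw [add_zero] at h1
    refine le_of_tendsto_of_tendsto (hc.const_sub (e L)).abs h1 ?_
    filter_upwards [eventually_gt_atTop 0] with L' hL'
    exact hpair L L' hL hL'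
  refine ⟨c, ?_⟩
  filter_upwards [hB] with ω hω
  rw [Metric.tendsto_nhds]
  intro ε hε
  obtain ⟨N, hN⟩ := exists_nat_gt (4 * C / ε)
  have hN0 : (0 : ℝ) < ((N + 1 : ℕ) : ℝ) := by positivity
  have h3 : C / ((N + 1 : ℕ) : ℝ) < ε / 4 := by
    rw [div_lt_iff₀ hN0]
    rw [div_lt_iff₀ hε] at hN
    push_cast
    nlinarith
  filter_upwards [hclose ω hω (N + 1) (by omega) (ε / 4) (by positivity)] with m hm
  have a1 := abs_le.1 hm
  have a2 := abs_le.1 (hec (N + 1) (by omega))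
  rw [Real.dist_eq, abs_lt]
  constructor <;> linarith [a1.1, a1.2, a2.1, a2.2]

/-- A set with τ_1-preimage equal to itself is invariant under the whole group, since τ_1 is
invertible and generates it. -/
theorem IsErgodicGroup.ergodic_one {τ : ℤ → Ω → Ω} [IsProbabilityMeasure P]
    (hτ : IsErgodicGroup P τ) : Ergodic (τ 1) P where
  toMeasurePreserving := hτ.measurePreserving 1
  aeconst_set s hs hinv := by
    have hbij : ∀ k ω, τ k (τ (-k) ω) = ω := fun k ω => by
      rw [← Function.comp_apply (f := τ k), ← hτ.map_add, add_neg_cancel, hτ.map_zero, id]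
    have hone : ∀ ω, τ 1 ω ∈ s ↔ ω ∈ s := fun ω => Set.ext_iff.1 hinv ω
    have hk : ∀ (k : ℤ) ω, τ k ω ∈ s ↔ ω ∈ s := by
      intro k
      induction k using Int.induction_on with
      | zero => intro ω; rw [hτ.map_zero, id]
      | succ k ih =>
        intro ω
        rw [add_comm, hτ.map_add, Function.comp_apply, hone, ih]
      | pred k ih =>
        intro ω
        rw [← hone, ← Function.comp_apply (f := τ 1), ← hτ.map_add,
          show (1 : ℤ) + (-k - 1) = -k by ring, ih]
    have himg : ∀ k, τ k '' s = s := fun k => by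
      ext ω
      constructor
      · rintro ⟨ω', h, rfl⟩
        exact (hk k ω').2 h
      · intro h
        exact ⟨τ (-k) ω, (hk (-k) ω).2 h, hbij k ω⟩
    rw [eventuallyConst_set]
    rcases hτ.ergodic s hs himg with h | h
    · left
      exact (mem_ae_iff_prob_eq_one hs).2 h
    · right
      exact measure_eq_zero_iff_ae_notMem.1 h

theorem IsErgodicGroup.iterate_one {τ : ℤ → Ω → Ω} (hτ : IsErgodicGroup P τ) (m : ℕ) :
    (τ 1)^[m] = τ m := by
  induction m with
  | zero => simp [hτ.map_zero]
  | succ m ih => rw [Function.iterate_succ', ih, ← hτ.map_add, Nat.cast_succ, add_comm]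

end Ergodic

/-! ### Support functions and the Hausdorff distance -/

section Convex

open Metric

theorem subset_of_tendsto_hausdorffDist {E : Type*} [NormedAddCommGroup E]
    {K : ℕ → Set E} {B D : Set E} (hD : IsClosed D)
    (hne : D.Nonempty) (hfin : ∀ m, hausdorffEDist (K m) D ≠ ⊤)
    (h : Tendsto (fun m => hausdorffDist (K m) D) atTop (𝓝 0))
    (hB : ∀ᶠ m in atTop, B ⊆ K m) : B ⊆ D := by
  intro x hx
  rw [hD.mem_iff_infDist_zero hne]
  refine le_antisymm (ge_of_tendsto h ?_) infDist_nonneg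
  filter_upwards [hB] with m hm
  exact infDist_le_hausdorffDist_of_mem (hm hx) (hfin m)

theorem subset_closedBall_of_tendsto_hausdorffDist {E : Type*} [NormedAddCommGroup E]
    {K : ℕ → Set E} {D : Set E} {r : ℕ → ℝ} {b : ℝ}
    (hfin : ∀ m, hausdorffEDist (K m) D ≠ ⊤)
    (h : Tendsto (fun m => hausdorffDist (K m) D) atTop (𝓝 0))
    (hr : Tendsto r atTop (𝓝 b)) (hK : ∀ᶠ m in atTop, K m ⊆ closedBall 0 (r m)) :
    D ⊆ closedBall 0 b := by
  intro x hx
  rw [mem_closedBall_zero_iff]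
  refine le_of_forall_pos_le_add fun ε hε => ?_
  refine ge_of_tendsto (hr.add_const ε) ?_
  filter_upwards [hK, h.eventually (gt_mem_nhds hε)] with m hm hd
  obtain ⟨y, hy, hxy⟩ := exists_dist_lt_of_hausdorffDist_lt' hx hd (hfin m)
  have h1 : ‖y‖ ≤ r m := by simpa using hm hy
  have h2 := norm_le_norm_add_norm_sub' x y
  rw [dist_comm, dist_eq_norm] at hxy
  linarith

variable {E : Type*} [NormedAddCommGroup E] [InnerProductSpace ℝ E]

/-- In finite dimension the convex hull of a compact set is compact. -/
theorem isCompact_convexHull [FiniteDimensional ℝ E] {s : Set E} (hs : IsCompact s) :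
    IsCompact (convexHull ℝ s) := by
  -- Carathéodory: combinations of at most dim + 1 points suffice, so the hull is a finite union of
  -- continuous images of compact sets.
  have h : convexHull ℝ s = ⋃ k ∈ Finset.range (Module.finrank ℝ E + 2),
      (fun p : (Fin k → ℝ) × (Fin k → E) => ∑ i, p.1 i • p.2 i) ''
        (stdSimplex ℝ (Fin k) ×ˢ Set.univ.pi fun _ => s) := by
    apply Set.Subset.antisymm
    · intro x hx
      obtain ⟨ι, hι, z, w, hz, hind, hw, hw1, rfl⟩ := eq_pos_convex_span_of_mem_convexHull hx
      have hcard : Fintype.card ι ≤ Module.finrank ℝ E + 1 :=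
        hind.card_le_finrank_succ.trans (Nat.succ_le_succ (Submodule.finrank_le _))
      let e := Fintype.equivFin ι
      refine Set.mem_biUnion (x := Fintype.card ι) (by simp; omega)
        ⟨(fun i => w (e.symm i), fun i => z (e.symm i)), ⟨⟨fun i => (hw _).le, ?_⟩, fun i _ => ?_⟩, ?_⟩
      · exact (e.symm.sum_comp w).trans hw1
      · exact hz ⟨_, rfl⟩
      · exact e.symm.sum_comp fun i => w i • z i
    · refine Set.iUnion₂_subset fun k _ => ?_
      rintro _ ⟨⟨w, z⟩, ⟨⟨hw, hw1⟩, hz⟩, rfl⟩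
      exact (convex_convexHull ℝ s).sum_mem (fun i _ => hw i) hw1
        fun i _ => subset_convexHull ℝ s (hz i trivial)
  rw [h]
  refine (Finset.range _).isCompact_biUnion fun k _ => ?_
  refine ((isCompact_stdSimplex ℝ (Fin k)).prod (isCompact_univ_pi fun _ => hs)).image ?_
  fun_prop

/-- The support function of a set. -/
noncomputable def supportFn (s : Set E) (u : E) : ℝ := sSup ((fun x => inner ℝ u x) '' s)

variable {s t : Set E} {u v x : E} {c M : ℝ}

theorem inner_le_supportFn (hs : s ⊆ closedBall 0 M) (hx : x ∈ s) : inner ℝ u x ≤ supportFn s u := by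
  refine le_csSup ⟨‖u‖ * M, ?_⟩ ⟨x, hx, rfl⟩
  rintro _ ⟨y, hy, rfl⟩
  refine (real_inner_le_norm u y).trans ?_
  gcongr
  simpa using hs hy

theorem supportFn_le (hs : s.Nonempty) (h : ∀ x ∈ s, inner ℝ u x ≤ c) : supportFn s u ≤ c :=
  csSup_le (hs.image _) (by rintro _ ⟨x, hx, rfl⟩; exact h x hx)

theorem supportFn_le_add (hs : s.Nonempty) (hM : s ⊆ closedBall 0 M) (u v : E) :
    supportFn s u ≤ supportFn s v + M * ‖u - v‖ := by
  refine supportFn_le hs fun x hx => ?_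
  have h1 := inner_le_supportFn (u := v) hM hx
  have h2 := real_inner_le_norm (u - v) x
  have h3 : ‖x‖ ≤ M := by simpa using hM hx
  rw [inner_sub_left] at h2
  nlinarith [norm_nonneg (u - v)]

theorem supportFn_convexHull (hs : s.Nonempty) (hM : s ⊆ closedBall 0 M) (u : E) :
    supportFn (convexHull ℝ s) u = supportFn s u := by
  have hM' : convexHull ℝ s ⊆ closedBall 0 M := convexHull_min hM (convex_closedBall 0 M)
  apply le_antisymm
  · refine supportFn_le hs.convexHull fun x hx => ?_
    have h : convexHull ℝ s ⊆ {y | inner ℝ u y ≤ supportFn s u} :=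
      convexHull_min (fun y hy => inner_le_supportFn hM hy)
        (convex_halfSpace_le (innerₛₗ ℝ u).isLinear _)
    exact h hx
  · exact supportFn_le hs fun x hx => inner_le_supportFn hM' (subset_convexHull ℝ s hx)

theorem supportFn_smul (hc : 0 ≤ c) (s : Set E) (u : E) :
    supportFn (c • s) u = c * supportFn s u := by
  rw [supportFn, supportFn, ← smul_eq_mul, ← Real.sSup_smul_of_nonneg hc, Set.image_smul_comm]
  intro x
  simp [inner_smul_right]

theorem supportFn_abs_le (hs : s.Nonempty) (hM : s ⊆ closedBall 0 M) (u : E) :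
    |supportFn s u| ≤ M * ‖u‖ := by
  have h0 : supportFn s 0 = 0 := by
    obtain ⟨x, hx⟩ := hs
    apply le_antisymm
    · exact supportFn_le ⟨x, hx⟩ fun y _ => by simp
    · simpa using inner_le_supportFn (u := 0) hM hx
  have h1 := supportFn_le_add hs hM u 0
  have h2 : -(M * ‖u‖) ≤ supportFn s u := by
    obtain ⟨x, hx⟩ := hs
    refine le_trans ?_ (inner_le_supportFn hM hx)
    have h3 := abs_le.1 (abs_real_inner_le_norm u x)
    have h4 : ‖x‖ ≤ M := by simpa using hM hx
    nlinarith [h3.1, norm_nonneg u]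
  rw [h0, sub_zero] at h1
  exact abs_le.2 ⟨h2, by linarith⟩

/-- Take y to be the projection of x on t and u the unit vector along x - y. Then y maximises ⟨u, ·⟩
on t, so |x - y| = ⟨u, x⟩ - ⟨u, y⟩ is at most the gap between the support functions at u. -/
theorem exists_dist_le_of_supportFn_le (hs : s ⊆ closedBall 0 M) (ht : IsCompact t)
    (htc : Convex ℝ t) (htn : t.Nonempty) {ε : ℝ} (hε : 0 ≤ ε)
    (h : ∀ u : E, ‖u‖ = 1 → supportFn s u ≤ supportFn t u + ε) (hx : x ∈ s) :
    ∃ y ∈ t, dist x y ≤ ε := by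
  obtain ⟨y, hy, hmin⟩ := exists_norm_eq_iInf_of_complete_convex htn ht.isComplete htc x
  rw [norm_eq_iInf_iff_real_inner_le_zero htc hy] at hmin
  refine ⟨y, hy, ?_⟩
  rw [dist_eq_norm]
  rcases eq_or_ne (x - y) 0 with h0 | h0
  · simpa [h0] using hε
  have hn : 0 < ‖x - y‖ := norm_pos_iff.2 h0
  set u := ‖x - y‖⁻¹ • (x - y) with hu
  have hu1 : ‖u‖ = 1 := by rw [hu, norm_smul, norm_inv, norm_norm, inv_mul_cancel₀ hn.ne']
  have h1 : supportFn t u ≤ inner ℝ u y := by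
    refine supportFn_le htn fun w hw => ?_
    have h2 := hmin w hw
    rw [inner_sub_right] at h2
    rw [hu, inner_smul_left, inner_smul_left]
    simp only [conj_trivial]
    exact mul_le_mul_of_nonneg_left (by linarith) (by positivity)
  have h2 := (inner_le_supportFn (u := u) hs hx).trans (h u hu1)
  have h3 : inner ℝ u x - inner ℝ u y = ‖x - y‖ := by
    rw [← inner_sub_right, hu, inner_smul_left, real_inner_self_eq_norm_sq]
    simp only [conj_trivial]
    field_simp
  linarith

theorem hausdorffDist_le_of_supportFn (hsc : IsCompact s) (hs : Convex ℝ s) (hsn : s.Nonempty)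
    (hsM : s ⊆ closedBall 0 M) (htc : IsCompact t) (ht : Convex ℝ t) (htn : t.Nonempty)
    (htM : t ⊆ closedBall 0 M) {ε : ℝ} (hε : 0 ≤ ε)
    (h : ∀ u : E, ‖u‖ = 1 → |supportFn s u - supportFn t u| ≤ ε) : hausdorffDist s t ≤ ε := by
  refine hausdorffDist_le_of_mem_dist hε (fun x hx => ?_) fun x hx => ?_
  · refine exists_dist_le_of_supportFn_le hsM htc ht htn hε (fun u hu => ?_) hx
    linarith [(abs_le.1 (h u hu)).2]
  · refine exists_dist_le_of_supportFn_le htM hsc hs hsn hε (fun u hu => ?_) hx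
    linarith [(abs_le.1 (h u hu)).1]

/-- For uniformly bounded compact convex sets, closeness of the support functions on a dense set
of directions implies closeness for the Hausdorff distance. -/
theorem tendsto_hausdorffDist_of_supportFn [FiniteDimensional ℝ E] {ι : Type*} {l : Filter ι}
    {K L : ι → Set E} {Q : Set E} (hQ : Dense Q)
    (hK : ∀ i, IsCompact (K i) ∧ Convex ℝ (K i) ∧ (K i).Nonempty ∧ K i ⊆ closedBall 0 M)
    (hL : ∀ i, IsCompact (L i) ∧ Convex ℝ (L i) ∧ (L i).Nonempty ∧ L i ⊆ closedBall 0 M)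
    (h : ∀ q ∈ Q, Tendsto (fun i => supportFn (K i) q - supportFn (L i) q) l (𝓝 0)) :
    Tendsto (fun i => hausdorffDist (K i) (L i)) l (𝓝 0) := by
  rcases l.eq_or_neBot with rfl | hl
  · exact tendsto_bot
  have hM : 0 ≤ M := by
    obtain ⟨i⟩ := l.nonempty_of_neBot
    obtain ⟨x, hx⟩ := (hK i).2.2.1
    exact (norm_nonneg x).trans (by simpa using (hK i).2.2.2 hx)
  rw [Metric.tendsto_nhds]
  intro ε hε
  -- Passing from u to a direction of a finite δ-net costs Mδ ≤ ε/4 for each of the two M-Lipschitz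
  -- support functions, and the gap on the net is at most ε/4.
  set δ := ε / (4 * (M + 1)) with hδ
  have hδ0 : 0 < δ := by positivity
  have hδM : M * δ ≤ ε / 4 := by
    have : (M + 1) * δ = ε / 4 := by rw [hδ]; field_simp
    linarith
  have : ProperSpace E := FiniteDimensional.proper ℝ E
  obtain ⟨F, hFQ, hF, hcov⟩ := (isCompact_sphere (0 : E) 1).elim_finite_subcover_image
    (b := Q) (c := fun q => ball q δ) (fun q _ => isOpen_ball) fun u _ => by
      obtain ⟨q, hq, hd⟩ := hQ.exists_dist_lt u hδ0
      exact Set.mem_biUnion hq hd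
  have hev : ∀ᶠ i in l, ∀ q ∈ F, |supportFn (K i) q - supportFn (L i) q| < ε / 4 := by
    rw [hF.eventually_all]
    intro q hq
    filter_upwards [(Metric.tendsto_nhds.1 (h q (hFQ hq))) (ε / 4) (by positivity)] with i hi
    simpa using hi
  filter_upwards [hev] with i hi
  rw [Real.dist_0_eq_abs, abs_of_nonneg hausdorffDist_nonneg]
  refine lt_of_le_of_lt (b := 3 * (ε / 4)) ?_ (by linarith)
  obtain ⟨k1, k2, k3, k4⟩ := hK i
  obtain ⟨l1, l2, l3, l4⟩ := hL i
  refine hausdorffDist_le_of_supportFn k1 k2 k3 k4 l1 l2 l3 l4 (by positivity) fun u hu => ?_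
  obtain ⟨q, hq, huq⟩ := Set.mem_iUnion₂.1 (hcov (by simpa using hu))
  rw [mem_ball, dist_eq_norm] at huq
  have hMu : M * ‖u - q‖ ≤ ε / 4 := (mul_le_mul_of_nonneg_left huq.le hM).trans hδM
  have a1 := supportFn_le_add k3 k4 u q
  have a2 := supportFn_le_add k3 k4 q u
  have a3 := supportFn_le_add l3 l4 u q
  have a4 := supportFn_le_add l3 l4 q u
  rw [norm_sub_rev q u] at a2 a4
  have a5 := abs_le.1 (hi q hq).le
  rw [abs_le]
  constructor <;> linarith [a5.1, a5.2]

theorem convex_of_tendsto_hausdorffDist {K : ℕ → Set E} {D : Set E}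
    (hK : ∀ m, Convex ℝ (K m)) (hD : IsClosed D)
    (hfin : ∀ m, hausdorffEDist (K m) D ≠ ⊤)
    (h : Tendsto (fun m => hausdorffDist (K m) D) atTop (𝓝 0)) : Convex ℝ D := by
  intro x hx y hy p q hp hq hpq
  rcases D.eq_empty_or_nonempty with rfl | hne
  · exact hx.elim
  rw [hD.mem_iff_infDist_zero hne]
  refine le_antisymm (le_of_forall_pos_le_add fun ε hε => ?_) infDist_nonneg
  obtain ⟨m, hm⟩ := (h.eventually (gt_mem_nhds (half_pos hε))).exists
  obtain ⟨x', hx', hxx⟩ := exists_dist_lt_of_hausdorffDist_lt' hx hm (hfin m)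
  obtain ⟨y', hy', hyy⟩ := exists_dist_lt_of_hausdorffDist_lt' hy hm (hfin m)
  obtain ⟨z, hz, hzz⟩ := exists_dist_lt_of_hausdorffDist_lt (hK m hx' hy' hp hq hpq) hm (hfin m)
  have h1 : dist (p • x + q • y) (p • x' + q • y') ≤ ε / 2 := by
    refine (dist_add_add_le _ _ _ _).trans ?_
    rw [dist_smul₀, dist_smul₀, Real.norm_of_nonneg hp, Real.norm_of_nonneg hq]
    rw [dist_comm] at hxx hyy
    nlinarith
  refine (infDist_le_dist_of_mem hz).trans ?_
  have := dist_triangle (p • x + q • y) (p • x' + q • y') z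
  linarith

/-- A uniformly bounded sequence of compact convex sets whose support functions converge on a
dense set of directions converges for the Hausdorff distance. -/
theorem exists_tendsto_hausdorffDist [FiniteDimensional ℝ E] {K : ℕ → Set E} {Q : Set E}
    (hQ : Dense Q)
    (hK : ∀ i, IsCompact (K i) ∧ Convex ℝ (K i) ∧ (K i).Nonempty ∧ K i ⊆ closedBall 0 M)
    {c : E → ℝ} (h : ∀ q ∈ Q, Tendsto (fun i => supportFn (K i) q) atTop (𝓝 (c q))) :
    ∃ D : Set E, IsCompact D ∧ Convex ℝ D ∧ D.Nonempty ∧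
      Tendsto (fun i => hausdorffDist (K i) D) atTop (𝓝 0) := by
  have : CompleteSpace E := FiniteDimensional.complete ℝ E
  let K' : ℕ → TopologicalSpace.NonemptyCompacts E := fun i => ⟨⟨K i, (hK i).1⟩, (hK i).2.2.1⟩
  have hcs : CauchySeq K' := by
    rw [cauchySeq_iff_tendsto_dist_atTop_0]
    -- Indexing by pairs turns the comparison criterion into the Cauchy property, so no candidate
    -- limit is needed.
    refine tendsto_hausdorffDist_of_supportFn (K := fun p : ℕ × ℕ => K p.1)
      (L := fun p : ℕ × ℕ => K p.2) hQ (fun p => hK p.1) (fun p => hK p.2) fun q hq => ?_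
    rw [← sub_self (c q), ← prod_atTop_atTop_eq]
    exact ((h q hq).comp tendsto_fst).sub ((h q hq).comp tendsto_snd)
  obtain ⟨D, hD⟩ := cauchySeq_tendsto_of_complete hcs
  have hlim : Tendsto (fun i => hausdorffDist (K i) (D : Set E)) atTop (𝓝 0) :=
    tendsto_iff_dist_tendsto_zero.1 hD
  refine ⟨D, D.isCompact, ?_, D.nonempty, hlim⟩
  refine convex_of_tendsto_hausdorffDist (fun m => (hK m).2.1) D.isCompact.isClosed (fun m => ?_) hlim
  exact hausdorffEDist_ne_top_of_nonempty_of_bounded (hK m).2.2.1 D.nonempty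
    (hK m).1.isBounded D.isCompact.isBounded

end Convex

/-! ### The speed constraint in integrated form -/

section Paths

variable {E : Type*} [NormedAddCommGroup E]

/-- The integrated form of the speed constraint `‖γ'(r)‖ ≤ b (γ r) r` on `[s, t]`. -/
def SpeedLE (b : E → ℝ → ℝ) (s t : ℝ) (γ : ℝ → E) : Prop :=
  ∀ r r', s ≤ r → r ≤ r' → r' ≤ t → ‖γ r' - γ r‖ ≤ ∫ u in r..r', b (γ u) u

variable {b : E → ℝ → ℝ} {s t m α β : ℝ} {γ γ₁ γ₂ : ℝ → E}

theorem SpeedLE.mono (h : SpeedLE b s t γ) {s' t' : ℝ} (hs : s ≤ s') (ht : t' ≤ t) :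
    SpeedLE b s' t' γ :=
  fun r r' h1 h2 h3 => h r r' (hs.trans h1) h2 (h3.trans ht)

theorem SpeedLE.congr (h : SpeedLE b s t γ₁) (he : Set.EqOn γ₁ γ₂ (Set.Icc s t)) :
    SpeedLE b s t γ₂ := by
  intro r r' h1 h2 h3
  rw [← he ⟨h1.trans h2, h3⟩, ← he ⟨h1, h2.trans h3⟩]
  refine (h r r' h1 h2 h3).trans_eq (intervalIntegral.integral_congr fun u hu => ?_)
  rw [Set.uIcc_of_le h2] at hu
  rw [he ⟨h1.trans hu.1, hu.2.trans h3⟩]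

theorem SpeedLE.norm_sub_le (hα : ∀ x r, 0 ≤ b x r) (hβ : ∀ x r, b x r ≤ β)
    (h : SpeedLE b s t γ) {r r' : ℝ} (h1 : s ≤ r) (h2 : r ≤ r') (h3 : r' ≤ t) :
    ‖γ r' - γ r‖ ≤ β * (r' - r) := by
  refine (h r r' h1 h2 h3).trans ((le_abs_self _).trans ?_)
  rw [← abs_of_nonneg (sub_nonneg.2 h2)]
  refine intervalIntegral.norm_integral_le_of_norm_le_const (f := fun u => b (γ u) u) fun u _ => ?_
  rw [Real.norm_of_nonneg (hα _ _)]
  exact hβ _ _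

theorem SpeedLE.dist_le (hα : ∀ x r, 0 ≤ b x r) (hβ : ∀ x r, b x r ≤ β)
    (h : SpeedLE b s t γ) {r r' : ℝ} (hr : r ∈ Set.Icc s t) (hr' : r' ∈ Set.Icc s t) :
    dist (γ r) (γ r') ≤ β * |r - r'| := by
  rcases le_total r r' with hle | hle
  · rw [dist_comm, dist_eq_norm, abs_sub_comm, abs_of_nonneg (sub_nonneg.2 hle)]
    exact h.norm_sub_le hα hβ hr.1 hle hr'.2
  · rw [dist_eq_norm, abs_of_nonneg (sub_nonneg.2 hle)]
    exact h.norm_sub_le hα hβ hr'.1 hle hr.2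

theorem SpeedLE.lipschitzOnWith (hα : ∀ x r, 0 ≤ b x r) (hβ : ∀ x r, b x r ≤ β)
    (h : SpeedLE b s t γ) : LipschitzOnWith β.toNNReal γ (Set.Icc s t) :=
  LipschitzOnWith.of_dist_le_mul fun r hr r' hr' => by
    rw [Real.coe_toNNReal _ ((hα (γ r) r).trans (hβ _ _)), Real.dist_eq]
    exact h.dist_le hα hβ hr hr'

theorem SpeedLE.intervalIntegrable (hb : Continuous fun p : E × ℝ => b p.1 p.2)
    (hα : ∀ x r, 0 ≤ b x r) (hβ : ∀ x r, b x r ≤ β) (h : SpeedLE b s t γ) {r r' : ℝ}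
    (h1 : s ≤ r) (h2 : r ≤ r') (h3 : r' ≤ t) :
    IntervalIntegrable (fun u => b (γ u) u) volume r r' := by
  apply ContinuousOn.intervalIntegrable
  rw [Set.uIcc_of_le h2]
  exact hb.comp_continuousOn (((h.lipschitzOnWith hα hβ).continuousOn.mono
    (Set.Icc_subset_Icc h1 h3)).prodMk continuousOn_id)

/-- Concatenation of paths. -/
theorem SpeedLE.glue (hb : Continuous fun p : E × ℝ => b p.1 p.2)
    (hα : ∀ x r, 0 ≤ b x r) (hβ : ∀ x r, b x r ≤ β)
    (h₁ : SpeedLE b s m γ₁) (h₂ : SpeedLE b m t γ₂) (he : γ₁ m = γ₂ m) :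
    SpeedLE b s t fun r => if r ≤ m then γ₁ r else γ₂ r := by
  set γ := fun r => if r ≤ m then γ₁ r else γ₂ r with hγ
  have h1 : SpeedLE b s m γ := h₁.congr fun r hr => by simp [hγ, hr.2]
  have h2 : SpeedLE b m t γ := h₂.congr fun r hr => by
    rcases hr.1.eq_or_lt with rfl | hlt
    · simp [hγ, he]
    · simp [hγ, hlt.not_ge]
  intro r r' hr hrr hr'
  rcases le_total r' m with hm | hm
  · exact h1 r r' hr hrr hm
  rcases le_total m r with hm' | hm'
  · exact h2 r r' hm' hrr hr'
  rw [← intervalIntegral.integral_add_adjacent_intervals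
    (h1.intervalIntegrable hb hα hβ hr hm' le_rfl) (h2.intervalIntegrable hb hα hβ le_rfl hm hr')]
  calc ‖γ r' - γ r‖ = ‖(γ m - γ r) + (γ r' - γ m)‖ := by congr 1; abel
    _ ≤ _ := (norm_add_le _ _).trans (add_le_add (h1 r m hr hm' le_rfl) (h2 m r' le_rfl hm hr'))

theorem SpeedLE.translate {b' : E → ℝ → ℝ} {l : E} (h : SpeedLE b s t γ)
    (hbb : ∀ x r, b' (x + l) (r + m) = b x r) :
    SpeedLE b' (s + m) (t + m) fun r => γ (r - m) + l := by
  intro r r' hr hrr hr'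
  have h1 := h (r - m) (r' - m) (by linarith) (by linarith) (by linarith)
  rw [add_sub_add_right_eq_sub]
  refine h1.trans_eq ?_
  rw [← intervalIntegral.integral_comp_sub_right (fun u => b (γ u) u) m]
  refine intervalIntegral.integral_congr fun u _ => ?_
  have := hbb (γ (u - m)) (u - m)
  rw [sub_add_cancel] at this
  exact this.symm

theorem speedLE_linear [NormedSpace ℝ E] (hb : Continuous fun p : E × ℝ => b p.1 p.2)
    (hα : ∀ x r, α ≤ b x r) {v : E} (hv : ‖v‖ ≤ α) (x : E) :
    SpeedLE b s t fun r => x + (r - s) • v := by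
  intro r r' _ hrr _
  have h1 : x + (r' - s) • v - (x + (r - s) • v) = (r' - r) • v := by
    rw [add_sub_add_left_eq_sub, ← sub_smul]; congr 1; ring
  rw [h1, norm_smul, Real.norm_of_nonneg (sub_nonneg.2 hrr)]
  have h2 : ∫ _ in r..r', α ≤ ∫ u in r..r', b (x + (u - s) • v) u := by
    refine intervalIntegral.integral_mono_on hrr intervalIntegrable_const ?_ fun u _ => hα _ _
    exact (hb.comp (by fun_prop : Continuous fun u : ℝ => (x + (u - s) • v, u))).intervalIntegrable _ _
  rw [intervalIntegral.integral_const, smul_eq_mul] at h2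
  exact (mul_le_mul_of_nonneg_left hv (sub_nonneg.2 hrr)).trans h2

/-- By continuity of u ↦ b (γ u) u at r, the path is Lipschitz near r with constant b (γ r) r + ε.
-/
theorem SpeedLE.norm_deriv_le [NormedSpace ℝ E] (hb : Continuous fun p : E × ℝ => b p.1 p.2)
    (hα : ∀ x r, 0 ≤ b x r) (h : SpeedLE b s t γ) {r : ℝ} (hr : r ∈ Set.Ioo s t)
    (hd : DifferentiableAt ℝ γ r) : ‖deriv γ r‖ ≤ b (γ r) r := by
  refine le_of_forall_pos_le_add fun ε hε => ?_
  have hcont : ContinuousAt (fun u => b (γ u) u) r :=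
    hb.continuousAt.comp (f := fun u => (γ u, u)) (hd.continuousAt.prodMk continuousAt_id)
  have hev : ∀ᶠ u in 𝓝 r, b (γ u) u < b (γ r) r + ε ∧ u ∈ Set.Ioo s t :=
    (hcont.eventually (gt_mem_nhds (lt_add_of_pos_right _ hε))).and (Ioo_mem_nhds hr.1 hr.2)
  obtain ⟨δ, hδ, hball⟩ := Metric.eventually_nhds_iff_ball.1 hev
  have key : ∀ p p', p ∈ Metric.ball r δ → p' ∈ Metric.ball r δ → p ≤ p' →
      ‖γ p' - γ p‖ ≤ (b (γ r) r + ε) * (p' - p) := by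
    intro p p' hp hp' hpp
    refine (h p p' (hball p hp).2.1.le hpp (hball p' hp').2.2.le).trans ((le_abs_self _).trans ?_)
    rw [← abs_of_nonneg (sub_nonneg.2 hpp)]
    refine intervalIntegral.norm_integral_le_of_norm_le_const (f := fun u => b (γ u) u) fun u hu => ?_
    rw [Real.norm_of_nonneg (hα _ _)]
    rw [Set.uIoc_of_le hpp] at hu
    have : u ∈ Metric.ball r δ :=
      (convex_ball r δ).ordConnected.out hp hp' ⟨hu.1.le, hu.2⟩
    exact (hball u this).1.le
  refine hd.hasDerivAt.le_of_lip' (add_nonneg (hα _ _) hε.le) ?_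
  filter_upwards [Metric.ball_mem_nhds r hδ] with p hp
  have hr0 : r ∈ Metric.ball r δ := Metric.mem_ball_self hδ
  rcases le_total r p with hle | hle
  · rw [Real.norm_of_nonneg (sub_nonneg.2 hle)]
    exact key r p hr0 hp hle
  · rw [norm_sub_rev, norm_sub_rev p r, Real.norm_of_nonneg (sub_nonneg.2 hle)]
    exact key p r hp hr0 hle

theorem _root_.AbsolutelyContinuousOnInterval.inner_left {E : Type*} [NormedAddCommGroup E]
    [InnerProductSpace ℝ E] {γ : ℝ → E} (h : AbsolutelyContinuousOnInterval γ s t) (d : E) :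
    AbsolutelyContinuousOnInterval (fun r => inner ℝ d (γ r)) s t := by
  unfold AbsolutelyContinuousOnInterval at h ⊢
  have h2 := h.const_mul ‖d‖
  rw [mul_zero] at h2
  refine squeeze_zero (fun I => Finset.sum_nonneg fun i _ => dist_nonneg) (fun I => ?_) h2
  rw [Finset.mul_sum]
  refine Finset.sum_le_sum fun i _ => ?_
  rw [Real.dist_eq, ← inner_sub_right, dist_eq_norm]
  exact abs_real_inner_le_norm _ _

/-- Pairing with the displacement d makes the problem scalar: the fundamental theorem for absolutely
continuous functions gives ‖d‖² = ∫⟨d, γ'⟩ ≤ ‖d‖ ∫ b. -/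
theorem speedLE_of_ae_norm_deriv_le {E : Type*} [NormedAddCommGroup E]
    [InnerProductSpace ℝ E] {b : E → ℝ → ℝ} {γ : ℝ → E}
    (hb : Continuous fun p : E × ℝ => b p.1 p.2) (hα : ∀ x r, 0 ≤ b x r)
    (h : AbsolutelyContinuousOnInterval γ s t)
    (hd : ∀ᵐ r, r ∈ Set.Icc s t → DifferentiableAt ℝ γ r ∧ ‖deriv γ r‖ ≤ b (γ r) r) :
    SpeedLE b s t γ := by
  intro r r' h1 h2 h3
  have hsub : Set.uIcc r r' ⊆ Set.uIcc s t := by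
    rw [Set.uIcc_of_le h2, Set.uIcc_of_le (h1.trans (h2.trans h3))]
    exact Set.Icc_subset_Icc h1 h3
  have h' := h.mono hsub
  set d := γ r' - γ r with hdef
  rcases eq_or_ne d 0 with h0 | h0
  · rw [h0, norm_zero]
    exact intervalIntegral.integral_nonneg h2 fun u _ => hα _ _
  have hpos : 0 < ‖d‖ := norm_pos_iff.2 h0
  have hac := h'.inner_left d
  have hint := hac.integral_deriv_eq_sub
  rw [← inner_sub_right, ← hdef, real_inner_self_eq_norm_sq] at hint
  have hbi : IntervalIntegrable (fun u => b (γ u) u) volume r r' :=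
    (hb.comp_continuousOn (h'.continuousOn.prodMk continuousOn_id)).intervalIntegrable
  have hle : ∫ u in r..r', deriv (fun r => inner ℝ d (γ r)) u
      ≤ ∫ u in r..r', ‖d‖ * b (γ u) u := by
    refine intervalIntegral.integral_mono_ae_restrict h2 hac.intervalIntegrable_deriv
      (hbi.const_mul _) ?_
    filter_upwards [ae_restrict_of_ae hd, ae_restrict_mem measurableSet_Icc] with u hu hmem
    obtain ⟨hdu, hnu⟩ := hu ⟨h1.trans hmem.1, hmem.2.trans h3⟩
    have hder : HasDerivAt (fun r => inner ℝ d (γ r)) (inner ℝ d (deriv γ u)) u := by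
      simpa using (hasDerivAt_const u d).inner ℝ hdu.hasDerivAt
    rw [hder.deriv]
    exact (real_inner_le_norm _ _).trans (mul_le_mul_of_nonneg_left hnu hpos.le)
  rw [hint, intervalIntegral.integral_const_mul] at hle
  nlinarith

/-- The integrated form has no almost-everywhere clause, hence is easy to glue, to translate and to
pass to limits. It recovers the differential form because Lipschitz curves are differentiable almost
everywhere. -/
theorem mem_admissible_iff {n : ℕ} {Ω : Type*} {a : EuclideanSpace ℝ (Fin n) → ℝ → Ω → ℝ} {ω : Ω}
    (ha : Continuous fun p : EuclideanSpace ℝ (Fin n) × ℝ => a p.1 p.2 ω)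
    (hα : ∀ x r, 0 ≤ a x r ω) (hβ : ∀ x r, a x r ω ≤ β) (hst : s ≤ t)
    {γ : ℝ → EuclideanSpace ℝ (Fin n)} :
    γ ∈ admissible a s t ω ↔ SpeedLE (fun x r => a x r ω) s t γ := by
  constructor
  · rintro ⟨h, hd⟩
    exact speedLE_of_ae_norm_deriv_le ha hα h hd
  · intro h
    have hlip := h.lipschitzOnWith hα hβ
    refine ⟨LipschitzOnWith.absolutelyContinuousOnInterval
      (by rw [Set.uIcc_of_le hst]; exact hlip), ?_⟩
    filter_upwards [hlip.ae_differentiableWithinAt_of_mem_real,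
      Measure.ae_ne volume s, Measure.ae_ne volume t] with r hr hrs hrt hmem
    have hio : r ∈ Set.Ioo s t := ⟨hmem.1.lt_of_ne' hrs, hmem.2.lt_of_ne hrt⟩
    have hda := (hr hmem).differentiableAt (Icc_mem_nhds hio.1 hio.2)
    exact ⟨hda, h.norm_deriv_le ha hα hio hda⟩

end Paths

/-! ### Compact spaces of curves and measurable selection of inequalities -/

section Compactness

/-- The existence of a solution, in a compact space, of countably many inequalities that are
continuous in the unknown and measurable in a parameter is a measurable property of the
parameter. -/
theorem measurableSet_exists_forall_le_zero {Ω K ι : Type*} [MeasurableSpace Ω]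
    [TopologicalSpace K] [CompactSpace K] [TopologicalSpace.SeparableSpace K] [Countable ι]
    {ψ : ι → K → Ω → ℝ} (hc : ∀ i ω, Continuous fun k => ψ i k ω)
    (hm : ∀ i k, Measurable (ψ i k)) : MeasurableSet {ω | ∃ k, ∀ i, ψ i k ω ≤ 0} := by
  classical
  obtain ⟨D, hDc, hD⟩ := TopologicalSpace.exists_countable_dense K
  -- Finitely many inequalities relaxed to < 1/(j+1) define an open set, so a countable dense set
  -- detects their solutions; the finite intersection property then yields an exact solution of all
  -- of them.
  have h : {ω | ∃ k, ∀ i, ψ i k ω ≤ 0} = ⋂ p : Finset ι × ℕ, ⋃ k ∈ D, ⋂ i ∈ p.1,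
      {ω | ψ i k ω < 1 / ((p.2 : ℝ) + 1)} := by
    ext ω
    simp only [Set.mem_ofPred_eq, Set.mem_iInter, Set.mem_iUnion, exists_prop]
    constructor
    · rintro ⟨k, hk⟩ ⟨s, j⟩
      have hopen : IsOpen (⋂ i ∈ s, {k | ψ i k ω < 1 / ((j : ℝ) + 1)}) :=
        isOpen_biInter_finset fun i _ => isOpen_lt (hc i ω) continuous_const
      have hne : (⋂ i ∈ s, {k | ψ i k ω < 1 / ((j : ℝ) + 1)}).Nonempty :=
        ⟨k, Set.mem_iInter₂.2 fun i _ => (hk i).trans_lt (by positivity)⟩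
      obtain ⟨k', hk', hD'⟩ := hD.exists_mem_open hopen hne
      exact ⟨k', hk', fun i hi => Set.mem_iInter₂.1 hD' i hi⟩
    · intro H
      let C : Finset ι × ℕ → Set K := fun p => ⋂ i ∈ p.1, {k | ψ i k ω ≤ 1 / ((p.2 : ℝ) + 1)}
      have hCc : ∀ p, IsClosed (C p) := fun p =>
        isClosed_biInter fun i _ => isClosed_le (hc i ω) continuous_const
      have hanti : Antitone C := by
        intro p q hpq k hk
        refine Set.mem_iInter₂.2 fun i hi => ?_
        refine le_trans (b := 1 / ((q.2 : ℝ) + 1)) (Set.mem_iInter₂.1 hk i (hpq.1 hi)) ?_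
        have : (p.2 : ℝ) ≤ q.2 := by exact_mod_cast hpq.2
        gcongr
      obtain ⟨k, hk⟩ := IsCompact.nonempty_iInter_of_directed_nonempty_isCompact_isClosed C
        hanti.directed_ge (fun p => by
          obtain ⟨k, _, hk⟩ := H p
          exact ⟨k, Set.mem_iInter₂.2 fun i hi => (hk i hi).le⟩)
        (fun p => (hCc p).isCompact) hCc
      refine ⟨k, fun i => ge_of_tendsto' tendsto_one_div_add_atTop_nhds_zero_nat fun j => ?_⟩
      exact Set.mem_iInter₂.1 (Set.mem_iInter.1 hk ({i}, j)) i (Finset.mem_singleton_self i)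
  rw [h]
  exact .iInter fun p => .biUnion hDc fun k _ =>
    .biInter p.1.countable_toSet fun i _ => measurableSet_lt (hm i k) measurable_const

variable {E : Type*} [NormedAddCommGroup E] {b : E → ℝ → ℝ} {t β : ℝ} {Y : Set E}

/-- The curves `ℝ → E` that start in `Y` at time `0` and have speed at most `β`. -/
def lipCurves (Y : Set E) (β : ℝ) : Set C(ℝ, E) :=
  {γ | γ 0 ∈ Y ∧ ∀ r r', dist (γ r) (γ r') ≤ β * |r - r'|}

theorem isCompact_lipCurves [ProperSpace E] (hY : IsCompact Y) (hβ : 0 ≤ β) :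
    IsCompact (lipCurves Y β) := by
  classical
  have hlip : ∀ f : ℝ → E, (∀ r r', dist (f r) (f r') ≤ β * |r - r'|) →
      LipschitzWith β.toNNReal f := fun f hf => LipschitzWith.of_dist_le_mul fun r r' => by
    rw [Real.coe_toNNReal _ hβ, Real.dist_eq]
    exact hf r r'
  apply ArzelaAscoli.isCompact_of_equicontinuous
  · have himg : ContinuousMap.toFun '' lipCurves Y β =
        {f : ℝ → E | f 0 ∈ Y ∧ ∀ r r', dist (f r) (f r') ≤ β * |r - r'|} := by
      ext f
      constructor
      · rintro ⟨γ, hγ, rfl⟩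
        exact hγ
      · intro hf
        exact ⟨⟨f, (hlip f hf.2).continuous⟩, hf, rfl⟩
    rw [himg]
    obtain ⟨M, hM⟩ := hY.isBounded.subset_closedBall 0
    refine (isCompact_univ_pi fun r : ℝ =>
      isCompact_closedBall (0 : E) (M + β * |r|)).of_isClosed_subset ?_ fun f hf r _ => ?_
    · refine IsClosed.and (hY.isClosed.preimage (continuous_apply 0)) ?_
      have : {f : ℝ → E | ∀ r r', dist (f r) (f r') ≤ β * |r - r'|} =
          ⋂ (r : ℝ) (r' : ℝ), {f | dist (f r) (f r') ≤ β * |r - r'|} := by ext f; simp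
      rw [this]
      exact isClosed_iInter fun r => isClosed_iInter fun r' =>
        isClosed_le ((continuous_apply r).dist (continuous_apply r')) continuous_const
    · have h1 := hM hf.1
      have h2 := hf.2 r 0
      rw [sub_zero] at h2
      rw [Metric.mem_closedBall] at h1 ⊢
      linarith [dist_triangle (f r) (f 0) 0]
  · exact (LipschitzWith.uniformEquicontinuous (fun γ : lipCurves Y β => (γ : ℝ → E)) β.toNNReal
      fun γ => hlip _ γ.2.2).equicontinuous

/-- The excess of the displacement of `γ` between two times in `[0, t]` over the one which the
speed bound `b` allows. -/
noncomputable def speedExcess (b : E → ℝ → ℝ) (t : ℝ) (p : ℝ × ℝ) (γ : ℝ → E) : ℝ :=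
  ‖γ (max 0 (min p.2 t)) - γ (max 0 (min p.1 t))‖
    - |∫ u in max 0 (min p.1 t)..max 0 (min p.2 t), b (γ u) u|

theorem continuous_speedExcess_curve (hb : Continuous fun p : E × ℝ => b p.1 p.2)
    (hβ : ∀ x r, |b x r| ≤ β) [SecondCountableTopology E] (p : ℝ × ℝ) :
    Continuous fun γ : C(ℝ, E) => speedExcess b t p γ := by
  refine Continuous.sub (by fun_prop) (Continuous.abs ?_)
  refine intervalIntegral.continuous_of_dominated_interval (bound := fun _ => β)
    (fun γ => ?_) (fun γ => ae_of_all _ fun u _ => hβ _ _) intervalIntegrable_const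
    (ae_of_all _ fun u _ => ?_)
  · exact (hb.comp (γ.continuous.prodMk continuous_id)).aestronglyMeasurable
  · exact hb.comp ((continuous_eval_const u).prodMk continuous_const)

theorem continuous_speedExcess_times (hb : Continuous fun p : E × ℝ => b p.1 p.2) (γ : C(ℝ, E)) :
    Continuous fun p : ℝ × ℝ => speedExcess b t p γ := by
  have hg : Continuous fun u => b (γ u) u := hb.comp (γ.continuous.prodMk continuous_id)
  have hF : Continuous fun r => ∫ u in (0 : ℝ)..r, b (γ u) u :=
    intervalIntegral.continuous_primitive (fun _ _ => hg.intervalIntegrable _ _) 0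
  have he : ∀ r r' : ℝ, ∫ u in r..r', b (γ u) u
      = (∫ u in (0 : ℝ)..r', b (γ u) u) - ∫ u in (0 : ℝ)..r, b (γ u) u := fun r r' =>
    (intervalIntegral.integral_interval_sub_left (hg.intervalIntegrable _ _)
      (hg.intervalIntegrable _ _)).symm
  have hγ := γ.continuous
  have h1 : Continuous fun p : ℝ × ℝ => max 0 (min p.1 t) := by fun_prop
  have h2 : Continuous fun p : ℝ × ℝ => max 0 (min p.2 t) := by fun_prop
  unfold speedExcess
  refine ((hγ.comp h2).sub (hγ.comp h1)).norm.sub ?_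
  exact (((hF.comp h2).sub (hF.comp h1)).congr fun p => (he _ _).symm).abs

/-- Clamping the times to [0, t] and taking the absolute value of the integral remove all order
conditions on the pair of times; continuity in the pair then reduces to rational times. -/
theorem speedLE_iff_speedExcess (hb : Continuous fun p : E × ℝ => b p.1 p.2)
    (hα : ∀ x r, 0 ≤ b x r) (ht : 0 ≤ t) (γ : C(ℝ, E)) :
    SpeedLE b 0 t γ ↔ ∀ q : ℚ × ℚ, speedExcess b t (q.1, q.2) γ ≤ 0 := by
  have hclamp : ∀ r : ℝ, 0 ≤ max 0 (min r t) ∧ max 0 (min r t) ≤ t := fun r =>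
    ⟨le_max_left _ _, max_le ht (min_le_right _ _)⟩
  constructor
  · intro h q
    rw [speedExcess, sub_nonpos]
    obtain ⟨h1, h2⟩ := hclamp q.1
    obtain ⟨h3, h4⟩ := hclamp q.2
    rcases le_total (max 0 (min (q.1 : ℝ) t)) (max 0 (min (q.2 : ℝ) t)) with hle | hle
    · exact (h _ _ h1 hle h4).trans (le_abs_self _)
    · rw [norm_sub_rev, intervalIntegral.integral_symm, abs_neg]
      exact (h _ _ h3 hle h2).trans (le_abs_self _)
  · intro h
    have hdense : DenseRange (Prod.map ((↑) : ℚ → ℝ) ((↑) : ℚ → ℝ)) :=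
      Rat.denseRange_cast.prodMap Rat.denseRange_cast
    have hall : ∀ p : ℝ × ℝ, speedExcess b t p γ ≤ 0 := fun p =>
      hdense.induction_on (p := fun p => speedExcess b t p γ ≤ 0) p
        (isClosed_le (continuous_speedExcess_times hb γ) continuous_const) h
    intro r r' h1 h2 h3
    have := hall (r, r')
    simp only [speedExcess, min_eq_left h3, min_eq_left (h2.trans h3), max_eq_right h1,
      max_eq_right (h1.trans h2), sub_nonpos] at this
    rwa [abs_of_nonneg (intervalIntegral.integral_nonneg h2 fun u _ => hα _ _)] at this

end Compactness

/-! ### Compactness, bounds and measurability of the reachable sets -/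

section Reach

variable {n : ℕ} {Ω : Type*} {a : EuclideanSpace ℝ (Fin n) → ℝ → Ω → ℝ} {α β t : ℝ} {ω : Ω}
  {y u : EuclideanSpace ℝ (Fin n)}

theorem isCompact_unitCell (n : ℕ) : IsCompact (unitCell n) := by
  have h : unitCell n = WithLp.ofLp ⁻¹' Set.univ.pi fun _ : Fin n => Set.Icc (0 : ℝ) 1 := by
    ext x
    simp [unitCell, Pi.le_def, forall_and]
  rw [h]
  exact (PiLp.homeomorph 2 fun _ : Fin n => ℝ).isCompact_preimage.2
    (isCompact_univ_pi fun _ => isCompact_Icc)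

theorem zero_mem_unitCell (n : ℕ) : (0 : EuclideanSpace ℝ (Fin n)) ∈ unitCell n :=
  fun i => by simp

theorem norm_le_of_mem_unitCell (hy : y ∈ unitCell n) : ‖y‖ ≤ √n := by
  rw [EuclideanSpace.norm_eq]
  apply Real.sqrt_le_sqrt
  refine (Finset.sum_le_sum fun i _ => ?_).trans (by simp : ∑ _i : Fin n, (1 : ℝ) ≤ n)
  rw [Real.norm_of_nonneg (hy i).1]
  exact pow_le_one₀ (hy i).1 (hy i).2

theorem mem_reachY_iff (ha : Continuous fun p : EuclideanSpace ℝ (Fin n) × ℝ => a p.1 p.2 ω)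
    (hα : ∀ x r, 0 ≤ a x r ω) (hβ : ∀ x r, a x r ω ≤ β) (ht : 0 ≤ t) :
    y ∈ reachY a t ω ↔ ∃ γ : ℝ → EuclideanSpace ℝ (Fin n),
      γ 0 ∈ unitCell n ∧ SpeedLE (fun x r => a x r ω) 0 t γ ∧ γ t = y := by
  simp only [reachY, Set.mem_iUnion, exists_prop, reach, Set.mem_ofPred_eq,
    mem_admissible_iff ha hα hβ ht]
  constructor
  · rintro ⟨x, hx, γ, hγ, rfl, rfl⟩
    exact ⟨γ, hx, hγ, rfl⟩
  · rintro ⟨γ, hx, hγ, rfl⟩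
    exact ⟨_, hx, γ, hγ, rfl, rfl⟩

theorem mem_reachY_iff_lipCurves
    (ha : Continuous fun p : EuclideanSpace ℝ (Fin n) × ℝ => a p.1 p.2 ω)
    (hα : ∀ x r, 0 ≤ a x r ω) (hβ : ∀ x r, a x r ω ≤ β) (ht : 0 ≤ t) :
    y ∈ reachY a t ω ↔ ∃ γ : lipCurves (unitCell n) β,
      (∀ q : ℚ × ℚ, speedExcess (fun x r => a x r ω) t (q.1, q.2) γ ≤ 0) ∧ γ.1 t = y := by
  rw [mem_reachY_iff ha hα hβ ht]
  constructor
  · rintro ⟨γ, h0, hγ, rfl⟩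
    have hβ0 : 0 ≤ β := (hα 0 0).trans (hβ 0 0)
    have hmem : ∀ r : ℝ, max 0 (min r t) ∈ Set.Icc 0 t := fun r =>
      ⟨le_max_left _ _, max_le ht (min_le_right _ _)⟩
    -- Freezing the path outside [0, t] gives a β-Lipschitz curve on all of ℝ.
    have hd : ∀ r r' : ℝ, dist (γ (max 0 (min r t))) (γ (max 0 (min r' t))) ≤ β * |r - r'| := by
      intro r r'
      refine (hγ.dist_le hα hβ (hmem r) (hmem r')).trans (mul_le_mul_of_nonneg_left ?_ hβ0)
      refine (abs_max_sub_max_le_max _ _ _ _).trans ?_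
      rw [sub_self, abs_zero]
      refine max_le (abs_nonneg _) ((abs_min_sub_min_le_max _ _ _ _).trans ?_)
      simp
    have hcont : Continuous fun r : ℝ => γ (max 0 (min r t)) :=
      (LipschitzWith.of_dist_le_mul (K := β.toNNReal) fun r r' => by
        rw [Real.coe_toNNReal _ hβ0, Real.dist_eq]; exact hd r r').continuous
    refine ⟨⟨⟨_, hcont⟩, ?_, hd⟩, ?_, ?_⟩
    · simpa [ht] using h0
    · refine (speedLE_iff_speedExcess ha hα ht _).1 (hγ.congr fun r hr => ?_)
      simp [hr.1, hr.2]
    · simp [ht]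
  · rintro ⟨γ, hγ, rfl⟩
    exact ⟨γ, γ.2.1, (speedLE_iff_speedExcess ha hα ht _).2 hγ, rfl⟩

theorem isCompact_reachY (ha : Continuous fun p : EuclideanSpace ℝ (Fin n) × ℝ => a p.1 p.2 ω)
    (hα : ∀ x r, 0 ≤ a x r ω) (hβ : ∀ x r, a x r ω ≤ β) (ht : 0 ≤ t) :
    IsCompact (reachY a t ω) := by
  have hβ0 : 0 ≤ β := (hα 0 0).trans (hβ 0 0)
  have : CompactSpace (lipCurves (unitCell n) β) :=
    isCompact_iff_compactSpace.1 (isCompact_lipCurves (isCompact_unitCell n) hβ0)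
  have h : reachY a t ω = (fun γ : lipCurves (unitCell n) β => γ.1 t) ''
      ⋂ q : ℚ × ℚ, {γ | speedExcess (fun x r => a x r ω) t (q.1, q.2) γ ≤ 0} := by
    ext y
    simp only [mem_reachY_iff_lipCurves ha hα hβ ht, Set.mem_image, Set.mem_iInter,
      Set.mem_ofPred_eq]
  rw [h]
  refine (isClosed_iInter fun q => ?_).isCompact.image (by fun_prop)
  exact isClosed_le ((continuous_speedExcess_curve ha (β := β)
    (fun x r => abs_le.2 ⟨by linarith [hα x r], hβ x r⟩) _).comp continuous_subtype_val)
    continuous_const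

theorem closedBall_subset_reachY
    (ha : Continuous fun p : EuclideanSpace ℝ (Fin n) × ℝ => a p.1 p.2 ω)
    (hα0 : 0 ≤ α) (hα : ∀ x r, α ≤ a x r ω) (hβ : ∀ x r, a x r ω ≤ β) (ht : 0 < t) :
    Metric.closedBall 0 (α * t) ⊆ reachY a t ω := by
  intro y hy
  rw [mem_reachY_iff ha (fun x r => hα0.trans (hα x r)) hβ ht.le]
  refine ⟨_, ?_, speedLE_linear ha hα (v := t⁻¹ • y) ?_ 0, ?_⟩
  · simpa using zero_mem_unitCell n
  · rw [norm_smul, norm_inv, Real.norm_of_nonneg ht.le, inv_mul_le_iff₀ ht, mul_comm]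
    simpa using hy
  · simp [smul_smul, ht.ne']

theorem reachY_subset_closedBall
    (ha : Continuous fun p : EuclideanSpace ℝ (Fin n) × ℝ => a p.1 p.2 ω)
    (hα : ∀ x r, 0 ≤ a x r ω) (hβ : ∀ x r, a x r ω ≤ β) (ht : 0 ≤ t) :
    reachY a t ω ⊆ Metric.closedBall 0 (√n + β * t) := by
  intro y hy
  obtain ⟨γ, h0, hγ, rfl⟩ := (mem_reachY_iff ha hα hβ ht).1 hy
  have h1 := hγ.norm_sub_le hα hβ le_rfl ht le_rfl
  have h2 := norm_le_of_mem_unitCell h0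
  have h3 := norm_le_norm_add_norm_sub' (γ t) (γ 0)
  rw [mem_closedBall_zero_iff]
  rw [sub_zero] at h1
  linarith

theorem unitCell_subset_reachY
    (ha : Continuous fun p : EuclideanSpace ℝ (Fin n) × ℝ => a p.1 p.2 ω)
    (hα : ∀ x r, 0 ≤ a x r ω) (hβ : ∀ x r, a x r ω ≤ β) (ht : 0 ≤ t) :
    unitCell n ⊆ reachY a t ω := by
  intro y hy
  rw [mem_reachY_iff ha hα hβ ht]
  exact ⟨fun r => y + (r - 0) • (0 : EuclideanSpace ℝ (Fin n)), by simpa using hy,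
    speedLE_linear ha hα (by simp) y, by simp⟩

theorem measurable_supportFn_reachY [MeasurableSpace Ω]
    (hm : Measurable fun p : (EuclideanSpace ℝ (Fin n) × ℝ) × Ω => a p.1.1 p.1.2 p.2)
    (ha : ∀ ω, Continuous fun p : EuclideanSpace ℝ (Fin n) × ℝ => a p.1 p.2 ω)
    (hα : ∀ x r ω, 0 ≤ a x r ω) (hβ : ∀ x r ω, a x r ω ≤ β) (ht : 0 ≤ t)
    (u : EuclideanSpace ℝ (Fin n)) : Measurable fun ω => supportFn (reachY a t ω) u := by
  rcases isEmpty_or_nonempty Ω with hΩ | ⟨⟨ω₀⟩⟩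
  · exact measurable_of_empty _
  have hβ0 : 0 ≤ β := (hα 0 0 ω₀).trans (hβ 0 0 ω₀)
  have : CompactSpace (lipCurves (unitCell n) β) :=
    isCompact_iff_compactSpace.1 (isCompact_lipCurves (isCompact_unitCell n) hβ0)
  refine measurable_of_Ici fun c => ?_
  -- The index `none` carries the condition c ≤ ⟨u, γ(t)⟩ on the end point, the others the speed
  -- constraint. Since the supremum is attained, a solution exists exactly when the support function
  -- is at least c.
  let ψ : Option (ℚ × ℚ) → lipCurves (unitCell n) β → Ω → ℝ := fun i γ ω =>
    i.elim (c - inner ℝ u (γ.1 t)) fun q => speedExcess (fun x r => a x r ω) t (q.1, q.2) γ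
  have h : (fun ω => supportFn (reachY a t ω) u) ⁻¹' Set.Ici c = {ω | ∃ γ, ∀ i, ψ i γ ω ≤ 0} := by
    ext ω
    have hmem : ∀ y, y ∈ reachY a t ω ↔ _ := fun y =>
      mem_reachY_iff_lipCurves (ha ω) (hα · · ω) (hβ · · ω) ht
    simp only [Set.mem_preimage, Set.mem_Ici, Set.mem_ofPred_eq, Option.forall, ψ, Option.elim,
      sub_nonpos]
    constructor
    · intro hc
      have hK := isCompact_reachY (ha ω) (hα · · ω) (hβ · · ω) ht
      obtain ⟨y, hy, hmax⟩ := hK.exists_isMaxOn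
        ⟨0, unitCell_subset_reachY (ha ω) (hα · · ω) (hβ · · ω) ht (zero_mem_unitCell n)⟩
        (by fun_prop : Continuous fun y => (inner ℝ u y : ℝ)).continuousOn
      obtain ⟨γ, hγ, rfl⟩ := (hmem y).1 hy
      exact ⟨γ, hc.trans (supportFn_le ⟨_, hy⟩ fun x hx => hmax hx), hγ⟩
    · rintro ⟨γ, hc, hγ⟩
      exact hc.trans (inner_le_supportFn
        (reachY_subset_closedBall (ha ω) (hα · · ω) (hβ · · ω) ht) ((hmem _).2 ⟨γ, hγ, rfl⟩))
  rw [h]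
  refine measurableSet_exists_forall_le_zero (fun i ω => ?_) fun i γ => ?_
  · cases i with
    | none => exact continuous_const.sub (continuous_const.inner (by fun_prop))
    | some q =>
      exact (continuous_speedExcess_curve (ha ω) (β := β)
        (fun x r => abs_le.2 ⟨by linarith [hα x r ω], hβ x r ω⟩) _).comp continuous_subtype_val
  · cases i with
    | none => exact measurable_const
    | some q =>
      have hsm : StronglyMeasurable fun p : Ω × ℝ => a (γ.1 p.2) p.2 p.1 := by
        refine (hm.comp (f := fun p : Ω × ℝ => ((γ.1 p.2, p.2), p.1)) ?_).stronglyMeasurable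
        exact ((γ.1.continuous.measurable.comp measurable_snd).prodMk measurable_snd).prodMk
          measurable_fst
      refine measurable_const.sub (Measurable.abs ?_)
      exact (hsm.integral_prod_right'.measurable).sub hsm.integral_prod_right'.measurable

end Reach

/-! ### Almost additivity of the support functions -/

section AlmostAdditive

variable {n : ℕ} {Ω : Type*} [MeasurableSpace Ω] {P : Measure Ω} {τ : ℤ → Ω → Ω}
  {a : EuclideanSpace ℝ (Fin n) → ℝ → Ω → ℝ} {α β : ℝ} {ω : Ω}

theorem AssumptionA.continuous (hA : AssumptionA τ a α β) (ω : Ω) :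
    Continuous fun p : EuclideanSpace ℝ (Fin n) × ℝ => a p.1 p.2 ω :=
  (hA.lipschitz ω).choose_spec.continuous

theorem AssumptionA.nonneg (hA : AssumptionA τ a α β) (x : EuclideanSpace ℝ (Fin n)) (r : ℝ)
    (ω : Ω) : 0 ≤ a x r ω :=
  hA.alpha_pos.le.trans (hA.lower x r ω)

theorem AssumptionA.translate (hA : AssumptionA τ a α β) (hτ : τ 0 = id)
    {l : EuclideanSpace ℝ (Fin n)} (hl : ∀ i, ∃ z : ℤ, l i = z) (m : ℕ)
    (x : EuclideanSpace ℝ (Fin n)) (r : ℝ) : a (x + l) (r + m) ω = a x r (τ m ω) := by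
  have h1 := hA.periodic_stationary x l hl (r + m) 0 ω
  have h2 := hA.periodic_stationary x 0 (fun i => ⟨0, by simp⟩) r m ω
  rw [hτ, id, Int.cast_zero, add_zero] at h1
  rw [add_zero, Int.cast_natCast] at h2
  rw [h1, h2]

theorem exists_lattice_sub_mem_unitCell (x : EuclideanSpace ℝ (Fin n)) :
    ∃ l : EuclideanSpace ℝ (Fin n), (∀ i, ∃ z : ℤ, l i = z) ∧ x - l ∈ unitCell n := by
  refine ⟨WithLp.toLp 2 fun i => (⌊x i⌋ : ℝ), fun i => ⟨⌊x i⌋, rfl⟩, fun i => ?_⟩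
  have h1 := Int.floor_le (x i)
  have h2 := Int.lt_floor_add_one (x i)
  simp only [PiLp.sub_apply]
  constructor <;> linarith

/-- Cut the path at time m and translate the remainder by the lattice vector l that brings γ(m) into
the unit cell; e = γ(m) - l is the rounding error. -/
theorem AssumptionA.exists_of_mem_reachY_add (hA : AssumptionA τ a α β) (hτ : τ 0 = id) {m k : ℕ}
    {y : EuclideanSpace ℝ (Fin n)} (hy : y ∈ reachY a ((m + k : ℕ) : ℝ) ω) :
    ∃ x ∈ reachY a m ω, ∃ z ∈ reachY a k (τ m ω), ∃ e ∈ unitCell n, y = x + z - e := by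
  obtain ⟨γ, h0, hγ, rfl⟩ := (mem_reachY_iff (hA.continuous ω) (hA.nonneg · · ω)
    (hA.upper · · ω) (Nat.cast_nonneg _)).1 hy
  push_cast at hγ ⊢
  obtain ⟨l, hl, he⟩ := exists_lattice_sub_mem_unitCell (γ m)
  refine ⟨γ m, ?_, γ (m + k) - l, ?_, γ m - l, he, by abel⟩
  · exact (mem_reachY_iff (hA.continuous ω) (hA.nonneg · · ω) (hA.upper · · ω)
      (Nat.cast_nonneg _)).2 ⟨γ, h0, hγ.mono le_rfl (by simp), rfl⟩
  · have h1 : SpeedLE (fun x r => a x r (τ m ω)) ((m : ℝ) + -m) ((m : ℝ) + k + -m)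
        fun r => γ (r - -m) + -l := by
      refine (hγ.mono (Nat.cast_nonneg m) le_rfl).translate fun x r => ?_
      rw [← hA.translate hτ hl, neg_add_cancel_right, neg_add_cancel_right]
    rw [add_neg_cancel, add_neg_cancel_comm] at h1
    refine (mem_reachY_iff (hA.continuous _) (hA.nonneg · · _) (hA.upper · · _)
      (Nat.cast_nonneg _)).2 ⟨_, ?_, h1, ?_⟩
    · simpa [← sub_eq_add_neg] using he
    · simp only [sub_neg_eq_add, ← sub_eq_add_neg, add_comm]

/-- Some lattice translate of γ₂(T) lies within √n ≤ αT of γ₁(m), so a segment of speed at most α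
reaches it in time T, just when the translated γ₂ passes there. The end point is off by the rounding
error and by γ₂(T), of norms at most √n and √n + βT. -/
theorem AssumptionA.exists_mem_reachY_add (hA : AssumptionA τ a α β) (hτ : τ 0 = id) {m k : ℕ}
    {x z : EuclideanSpace ℝ (Fin n)} (hx : x ∈ reachY a m ω) (hz : z ∈ reachY a k (τ m ω))
    {T : ℝ} (hT0 : 0 < T) (hT : √n ≤ α * T) :
    ∃ y ∈ reachY a ((m + k : ℕ) : ℝ) ω, ‖y - (x + z)‖ ≤ 2 * √n + β * T := by
  have hc := hA.continuous ω
  have hn : ∀ x r, 0 ≤ a x r ω := (hA.nonneg · · ω)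
  have hu : ∀ x r, a x r ω ≤ β := (hA.upper · · ω)
  obtain ⟨γ₁, h0, hγ₁, rfl⟩ := (mem_reachY_iff hc hn hu (Nat.cast_nonneg _)).1 hx
  obtain ⟨γ₂, h0', hγ₂, rfl⟩ := (mem_reachY_iff (hA.continuous _) (hA.nonneg · · _)
    (hA.upper · · _) (Nat.cast_nonneg _)).1 hz
  have hbound : ∀ r : ℝ, 0 ≤ r → r ≤ k → ‖γ₂ r‖ ≤ √n + β * r := fun r hr hrk => by
    have h1 := hγ₂.norm_sub_le (hA.nonneg · · _) (hA.upper · · _) le_rfl hr hrk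
    have h2 := norm_le_norm_add_norm_sub' (γ₂ r) (γ₂ 0)
    have h3 := norm_le_of_mem_unitCell h0'
    rw [sub_zero] at h1
    linarith
  have hm0 : (0 : ℝ) ≤ m := m.cast_nonneg
  have hsq : 0 ≤ √(n : ℝ) := Real.sqrt_nonneg _
  have hmk : (0 : ℝ) ≤ m + k := by positivity
  rw [Nat.cast_add]
  rcases le_or_gt T k with hTk | hTk
  · obtain ⟨l, hl, he⟩ := exists_lattice_sub_mem_unitCell (γ₁ m - γ₂ T)
    have hne := norm_le_of_mem_unitCell he
    have h2 : SpeedLE (fun x r => a x r ω) (T + m) ((k : ℝ) + m) fun r => γ₂ (r - m) + l :=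
      (hγ₂.mono hT0.le le_rfl).translate fun x r => hA.translate hτ hl m x r
    have hv : ‖T⁻¹ • (γ₂ T + l - γ₁ m)‖ ≤ α := by
      rw [norm_smul, norm_inv, Real.norm_of_nonneg hT0.le, inv_mul_le_iff₀ hT0, mul_comm,
        norm_sub_rev, ← sub_sub]
      exact hne.trans hT
    have h3 : SpeedLE (fun x r => a x r ω) m (T + m) _ :=
      speedLE_linear hc (hA.lower · · ω) hv (γ₁ m)
    have h4 := hγ₁.glue hc hn hu (h3.glue hc hn hu h2 (by simp [smul_smul, hT0.ne']))
      (by simp [hT0.le])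
    refine ⟨_, (mem_reachY_iff hc hn hu hmk).2
      ⟨_, ?_, by rwa [add_comm (k : ℝ)] at h4, rfl⟩, ?_⟩
    · simpa using h0
    · have hend : ∀ w, (if (m : ℝ) + k ≤ m then γ₁ (m + k) else
          if (m : ℝ) + k ≤ T + m then w else γ₂ (m + k - m) + l) = _ := fun w => by
        rw [if_neg (by linarith)]
      rw [hend]
      have hval : (if (m : ℝ) + k ≤ T + m then γ₁ m + ((m : ℝ) + k - m) • T⁻¹ • (γ₂ T + l - γ₁ m)
          else γ₂ (m + k - m) + l) = γ₂ k + l := by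
        -- If k = T the final time still belongs to the connecting segment, whose end point is γ₂(T)
        -- + l.
        split_ifs with hif
        · have : (k : ℝ) = T := le_antisymm (by linarith) hTk
          rw [add_sub_cancel_left, this, smul_smul, mul_inv_cancel₀ hT0.ne', one_smul]
          abel
        · rw [add_sub_cancel_left]
      rw [hval]
      have heq : γ₂ k + l - (γ₁ m + γ₂ k) = -(γ₁ m - γ₂ T - l) - γ₂ T := by abel
      rw [heq]
      refine (norm_sub_le _ _).trans ?_
      rw [norm_neg]
      linarith [hbound T hT0.le hTk]
  · refine ⟨γ₁ m, (mem_reachY_iff hc hn hu hmk).2 ⟨_, ?_, hγ₁.glue hc hn hu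
      (speedLE_linear (v := 0) hc hn (by simp) (γ₁ m)) (by simp), ?_⟩, ?_⟩
    · simpa using h0
    · by_cases hk : (k : ℝ) ≤ 0
      · have hk0 : (k : ℝ) = 0 := le_antisymm hk k.cast_nonneg
        simp [hk0]
      · simp [hk]
    · rw [sub_add_cancel_left, norm_neg]
      have h1 := hbound k k.cast_nonneg le_rfl
      have h2 : β * k ≤ β * T := mul_le_mul_of_nonneg_left hTk.le hA.beta_pos.le
      linarith

theorem AssumptionA.reachY_nonempty (hA : AssumptionA τ a α β) (m : ℕ) (ω : Ω) :
    (reachY a m ω).Nonempty :=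
  ⟨0, unitCell_subset_reachY (hA.continuous ω) (hA.nonneg · · ω) (hA.upper · · ω) m.cast_nonneg
    (zero_mem_unitCell n)⟩

theorem AssumptionA.reachY_subset_closedBall (hA : AssumptionA τ a α β) (m : ℕ) (ω : Ω) :
    reachY a m ω ⊆ Metric.closedBall 0 (√n + β * m) :=
  ReachableSets.reachY_subset_closedBall (hA.continuous ω) (hA.nonneg · · ω) (hA.upper · · ω)
    m.cast_nonneg

theorem AssumptionA.supportFn_reachY_almost_additive (hA : AssumptionA τ a α β) (hτ : τ 0 = id)
    (m k : ℕ) (ω : Ω) (u : EuclideanSpace ℝ (Fin n)) {T : ℝ} (hT0 : 0 < T) (hT : √n ≤ α * T) :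
    |supportFn (reachY a ((m + k : ℕ) : ℝ) ω) u - supportFn (reachY a m ω) u
      - supportFn (reachY a k (τ m ω)) u| ≤ (2 * √n + β * T) * ‖u‖ := by
  have hsq : 0 ≤ √(n : ℝ) := Real.sqrt_nonneg _
  have hβT : 0 ≤ β * T := mul_nonneg hA.beta_pos.le hT0.le
  have hnu := norm_nonneg u
  have hle : supportFn (reachY a ((m + k : ℕ) : ℝ) ω) u ≤ supportFn (reachY a m ω) u
      + supportFn (reachY a k (τ m ω)) u + (2 * √n + β * T) * ‖u‖ := by
    refine supportFn_le (hA.reachY_nonempty _ _) fun y hy => ?_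
    obtain ⟨x, hx, z, hz, e, he, rfl⟩ := hA.exists_of_mem_reachY_add hτ hy
    have h1 := inner_le_supportFn (u := u) (hA.reachY_subset_closedBall _ _) hx
    have h2 := inner_le_supportFn (u := u) (hA.reachY_subset_closedBall _ _) hz
    have h3 := (abs_le.1 (abs_real_inner_le_norm u e)).1
    have h4 := norm_le_of_mem_unitCell he
    rw [inner_sub_right, inner_add_right]
    nlinarith
  have hge : supportFn (reachY a m ω) u ≤ supportFn (reachY a ((m + k : ℕ) : ℝ) ω) u
      - supportFn (reachY a k (τ m ω)) u + (2 * √n + β * T) * ‖u‖ := by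
    refine supportFn_le (hA.reachY_nonempty _ _) fun x hx => ?_
    rw [sub_add_eq_add_sub, le_sub_comm]
    refine supportFn_le (hA.reachY_nonempty _ _) fun z hz => ?_
    obtain ⟨y, hy, hyx⟩ := hA.exists_mem_reachY_add hτ hx hz hT0 hT
    have h1 := inner_le_supportFn (u := u) (hA.reachY_subset_closedBall _ _) hy
    have h2 := (abs_le.1 (abs_real_inner_le_norm u (y - (x + z)))).1
    rw [inner_sub_right, inner_add_right] at h2
    nlinarith
  rw [abs_le]
  constructor <;> linarith

theorem AssumptionA.exists_ae_tendsto_supportFn [IsProbabilityMeasure P]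
    (hτ : IsErgodicGroup P τ) (hA : AssumptionA τ a α β) (u : EuclideanSpace ℝ (Fin n)) :
    ∃ c : ℝ, ∀ᵐ ω ∂P,
      Tendsto (fun m : ℕ => supportFn (reachY a m ω) u / m) atTop (𝓝 c) := by
  have hα := hA.alpha_pos
  -- The delay is √n/α + 1; the summand 1 keeps it positive when n = 0.
  refine exists_ae_tendsto_div_of_almost_additive (T := τ 1)
    (C := (2 * √n + β * (√n / α + 1)) * ‖u‖) (B := fun m => (√n + β * m) * ‖u‖) hτ.ergodic_one
    (fun m => measurable_supportFn_reachY hA.measurable hA.continuous hA.nonneg hA.upper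
      m.cast_nonneg u) (fun m k ω => ?_)
    fun m ω => supportFn_abs_le (hA.reachY_nonempty _ _) (hA.reachY_subset_closedBall _ _) u
  rw [hτ.iterate_one]
  refine hA.supportFn_reachY_almost_additive hτ.map_zero m k ω u (by positivity) ?_
  rw [mul_add, mul_div_cancel₀ _ hα.ne']
  linarith

end AlmostAdditive

/-! ### Bounds for the scaled hulls -/

section Limit

variable {n : ℕ} {Ω : Type*} [MeasurableSpace Ω] {τ : ℤ → Ω → Ω}
  {a : EuclideanSpace ℝ (Fin n) → ℝ → Ω → ℝ} {α β : ℝ}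

/-- The radius tends to β, which is what yields the outer ball for the limit D. -/
theorem AssumptionA.scaledHull_subset_closedBall (hA : AssumptionA τ a α β) (m : ℕ) (ω : Ω) :
    (m : ℝ)⁻¹ • convexHull ℝ (reachY a (m : ℝ) ω) ⊆ Metric.closedBall 0 ((m : ℝ)⁻¹ * √n + β) := by
  rintro _ ⟨y, hy, rfl⟩
  have h1 : ‖y‖ ≤ √n + β * m := by
    simpa using convexHull_min (hA.reachY_subset_closedBall m ω) (convex_closedBall 0 _) hy
  have h2 : (m : ℝ)⁻¹ * (β * m) ≤ β := by
    rw [mul_left_comm]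
    exact mul_le_of_le_one_right hA.beta_pos.le (inv_mul_le_one)
  have h3 : (m : ℝ)⁻¹ * ‖y‖ ≤ (m : ℝ)⁻¹ * (√n + β * m) := by gcongr
  simp only [mem_closedBall_zero_iff, norm_smul, norm_inv, RCLike.norm_natCast]
  linarith

/-- The index m = 0 is harmless: its scaling factor is 0⁻¹ = 0, so the set is {0}. -/
theorem AssumptionA.scaledHull_props (hA : AssumptionA τ a α β) (m : ℕ) (ω : Ω) :
    IsCompact ((m : ℝ)⁻¹ • convexHull ℝ (reachY a (m : ℝ) ω)) ∧
    Convex ℝ ((m : ℝ)⁻¹ • convexHull ℝ (reachY a (m : ℝ) ω)) ∧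
    ((m : ℝ)⁻¹ • convexHull ℝ (reachY a (m : ℝ) ω)).Nonempty ∧
    (m : ℝ)⁻¹ • convexHull ℝ (reachY a (m : ℝ) ω) ⊆ Metric.closedBall 0 (√n + β) := by
  refine ⟨(isCompact_convexHull (isCompact_reachY (hA.continuous ω) (hA.nonneg · · ω)
    (hA.upper · · ω) m.cast_nonneg)).smul _, (convex_convexHull ℝ _).smul _,
    (hA.reachY_nonempty m ω).convexHull.smul_set,
    (hA.scaledHull_subset_closedBall m ω).trans (Metric.closedBall_subset_closedBall ?_)⟩
  gcongr
  exact mul_le_of_le_one_left (Real.sqrt_nonneg _) (Nat.cast_inv_le_one m)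

theorem AssumptionA.closedBall_subset_scaledHull (hA : AssumptionA τ a α β) {m : ℕ} (hm : 0 < m)
    (ω : Ω) : Metric.closedBall 0 α ⊆ (m : ℝ)⁻¹ • convexHull ℝ (reachY a (m : ℝ) ω) := by
  intro y hy
  have hm' : (0 : ℝ) < m := by exact_mod_cast hm
  rw [Set.mem_inv_smul_set_iff₀ hm'.ne']
  refine subset_convexHull ℝ _ (closedBall_subset_reachY (hA.continuous ω) hA.alpha_pos.le
    (hA.lower · · ω) (hA.upper · · ω) hm' ?_)
  rw [mem_closedBall_zero_iff] at hy ⊢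
  rw [norm_smul, Real.norm_of_nonneg hm'.le, mul_comm]
  gcongr

theorem hausdorffDist_smul_add_neg_unitCell_le (A : Set (EuclideanSpace ℝ (Fin n))) {c : ℝ}
    (hc : 0 ≤ c) : Metric.hausdorffDist (c • (A + -unitCell n)) (c • A) ≤ c * √n := by
  refine Metric.hausdorffDist_le_of_mem_dist (by positivity) ?_ ?_
  · rintro _ ⟨_, ⟨p, hp, e, he, rfl⟩, rfl⟩
    refine ⟨c • p, ⟨p, hp, rfl⟩, ?_⟩
    simp only [dist_smul₀, Real.norm_of_nonneg hc, dist_self_add_left]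
    rw [← norm_neg]
    exact mul_le_mul_of_nonneg_left (norm_le_of_mem_unitCell he) hc
  · rintro _ ⟨p, hp, rfl⟩
    refine ⟨c • p, ⟨p, ⟨p, hp, 0, ?_, add_zero p⟩, rfl⟩, ?_⟩
    · simpa using zero_mem_unitCell n
    · rw [dist_self]
      positivity

end Limit

end ReachableSets

/-! ### The limit shape -/

theorem mainTheorem4 {n : ℕ} {Ω : Type*} [MeasurableSpace Ω] (P : Measure Ω)
    [IsProbabilityMeasure P] (τ : ℤ → Ω → Ω) (hτ : ReachableSets.IsErgodicGroup P τ)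
    (a : EuclideanSpace ℝ (Fin n) → ℝ → Ω → ℝ) (α β : ℝ)
    (hA : ReachableSets.AssumptionA τ a α β) :
    ∃ D : Set (EuclideanSpace ℝ (Fin n)),
      IsCompact D ∧ Convex ℝ D ∧
      Metric.closedBall 0 α ⊆ D ∧ D ⊆ Metric.closedBall 0 β ∧
      ∃ Ω₀ : Set Ω, MeasurableSet Ω₀ ∧ P Ω₀ = 1 ∧
        ∀ ω ∈ Ω₀,
          ReachableSets.TendstoHausdorff
            (fun m : ℕ => (m : ℝ)⁻¹ • ReachableSets.X τ a 0 m ω) D ∧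
          ReachableSets.TendstoHausdorff
            (fun m : ℕ => (m : ℝ)⁻¹ • convexHull ℝ (ReachableSets.reachY a (m : ℝ) ω)) D := by
  open ReachableSets in
  obtain ⟨Q, hQc, hQ⟩ := TopologicalSpace.exists_countable_dense (EuclideanSpace ℝ (Fin n))
  choose c hc using hA.exists_ae_tendsto_supportFn hτ
  obtain ⟨Ω₀, hΩ₀, hm, hgood⟩ := ((ae_ball_iff hQc).2 fun q _ => hc q).exists_measurable_mem
  set K : Ω → ℕ → Set (EuclideanSpace ℝ (Fin n)) := fun ω m =>
    (m : ℝ)⁻¹ • convexHull ℝ (reachY a (m : ℝ) ω) with hK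
  have hprops : ∀ ω m, _ := fun ω m => hA.scaledHull_props m ω
  have hlim : ∀ ω ∈ Ω₀, ∀ q ∈ Q,
      Tendsto (fun m => supportFn (K ω m) q) atTop (𝓝 (c q)) := by
    intro ω hω q hq
    refine (hgood ω hω q hq).congr fun m => ?_
    rw [hK, supportFn_smul (by positivity), supportFn_convexHull (hA.reachY_nonempty m ω)
      (hA.reachY_subset_closedBall m ω), div_eq_inv_mul]
  have hne : Ω₀.Nonempty := Filter.nonempty_of_mem hΩ₀
  -- D is built from a single good sample ω₀. Any other good ω has the same limits c(q), so its
  -- hulls approach those of ω₀ and hence D.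
  obtain ⟨ω₀, hω₀⟩ := hne
  obtain ⟨D, hDc, hDconv, hDne, hD⟩ :=
    exists_tendsto_hausdorffDist hQ (hprops ω₀) (hlim ω₀ hω₀)
  have hfin : ∀ ω m, Metric.hausdorffEDist (K ω m) D ≠ ⊤ := fun ω m =>
    Metric.hausdorffEDist_ne_top_of_nonempty_of_bounded (hprops ω m).2.2.1 hDne
      (hprops ω m).1.isBounded hDc.isBounded
  have hKD : ∀ ω ∈ Ω₀, Tendsto (fun m => Metric.hausdorffDist (K ω m) D) atTop (𝓝 0) := by
    intro ω hω
    have h1 := tendsto_hausdorffDist_of_supportFn hQ (hprops ω) (hprops ω₀) fun q hq => by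
      simpa using (hlim ω hω q hq).sub (hlim ω₀ hω₀ q hq)
    have h2 := h1.add hD
    rw [add_zero] at h2
    exact squeeze_zero (fun m => Metric.hausdorffDist_nonneg)
      (fun m => Metric.hausdorffDist_triangle' (hfin ω₀ m)) h2
  refine ⟨D, hDc, hDconv, ?_, ?_, Ω₀, hm, (mem_ae_iff_prob_eq_one hm).1 hΩ₀, fun ω hω => ⟨?_, ?_⟩⟩
  · refine subset_of_tendsto_hausdorffDist hDc.isClosed hDne (hfin ω₀) hD ?_
    filter_upwards [eventually_gt_atTop 0] with m hm
    exact hA.closedBall_subset_scaledHull hm ω₀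
  · refine subset_closedBall_of_tendsto_hausdorffDist (hfin ω₀) hD ?_
      (Eventually.of_forall fun m => hA.scaledHull_subset_closedBall m ω₀)
    simpa using ((tendsto_inv_atTop_nhds_zero_nat (𝕜 := ℝ)).mul_const √(n : ℝ)).add_const β
  · have hX : ∀ m, X τ a 0 m ω = convexHull ℝ (reachY a (m : ℝ) ω) + -unitCell n := fun m => by
      simp [X, hτ.map_zero]
    simp only [hX]
    refine ⟨fun m _ => ⟨?_, ?_⟩, ⟨hDne, hDc⟩, ?_⟩
    · exact ((hA.reachY_nonempty m ω).convexHull.add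
        (Set.Nonempty.neg ⟨0, zero_mem_unitCell n⟩)).smul_set
    · exact ((isCompact_convexHull (isCompact_reachY (hA.continuous ω) (hA.nonneg · · ω)
        (hA.upper · · ω) m.cast_nonneg)).add (isCompact_unitCell n).neg).smul _
    -- Adding -Y before scaling displaces points by at most √n, hence by √n/m afterwards.
    · have h1 : Tendsto (fun m : ℕ => (m : ℝ)⁻¹ * √(n : ℝ) + Metric.hausdorffDist (K ω m) D)
          atTop (𝓝 0) := by
        simpa using ((tendsto_inv_atTop_nhds_zero_nat (𝕜 := ℝ)).mul_const √(n : ℝ)).add (hKD ω hω)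
      refine squeeze_zero (fun m => Metric.hausdorffDist_nonneg) (fun m => ?_) h1
      refine (Metric.hausdorffDist_triangle' (hfin ω m)).trans (add_le_add ?_ le_rfl)
      exact hausdorffDist_smul_add_neg_unitCell_le _ (by positivity)
  · exact ⟨fun m _ => ⟨(hprops ω m).2.2.1, (hprops ω m).1⟩, ⟨hDne, hDc⟩, hKD ω hω⟩
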